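/- **Setting.** A parametric timed automaton (PTA) $\mathcal A$ has finite sets of actions, locations $L$ (with an initial location $\ell_0$), clocks $X$ and parameters $P$, an invariant $I(\ell)$ for every location, and finitely many edges $e=(\ell,g,a,R,\ell')$ with $R\subseteq X$ the set of clocks to be reset; guards $g$ and invariants are conjunctions of inequalities $x\bowtie d$ or $x\bowtie p$ with $x\in X$, $d\in\mathbb N$, $p\in P$, ${\bowtie}\in\{<,\le,=,\ge,>\}$. For a parameter valuation $v:P\to\mathbb Q_{\ge 0}$, the states of the timed automaton $v(\mathcal A)$ are the pairs $(\ell,w)$ with $w:X\to\mathbb R_{\ge 0}$ and $w\models v(I(\ell))$; a run starts in $(\ell_0,\vec 0)$ (which has to be a state) and is a sequence of steps, each a delay during which the invariant holds, followed by an edge whose guard holds, which resets the clocks in $R$ and leads to a state. For $T\subseteq L$, $\mathit{Reach}(v(\mathcal A),T)$ is the set of finite runs of $v(\mathcal A)$ that end in a location of $T$. The minimum of a set of non-negative numbers is $\infty$ if the set is empty, and otherwise $(c,=)$ or $(c,>)$, where $c$ is the infimum and the symbol tells whether $c$ belongs to the set; minima are ordered lexicographically with ${=}<{>}$ and with $\infty$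 largest. A number $c$ is identified with $(c,=)$. For $p\in P$ let $$\mathit{MinParamReach}(\mathcal A,p,T)=\min\{v(p)\mid \mathit{Reach}(v(\mathcal A),T)\ne\emptyset\},$$ $$\mathit{MinParamSynth}(\mathcal A,p,T)=\{v\mid \mathit{Reach}(v(\mathcal A),T)\neq\emptyset,\ v(p)=\mathit{MinParamReach}(\mathcal A,p,T)\}.$$ A polyhedron over $P$ is the set of valuations $v$ that satisfy a given finite conjunction of inequalities $\sum_j\beta_j p_j+d\bowtie 0$ with integer coefficients. **Algorithm MinParamSynth.** A symbolic state is a pair $s=(\ell,C)$ of a location and a zone $C\subseteq\mathbb R_{\ge0}^X\times\mathbb Q_{\ge0}^P$. Write $C^{\nearrow}$ for time elapsing, $[C]_R$ for the reset of the clocks in $R$, $C{\downarrow_P}$ for the projection onto the parameters, and $\mathit{GetMin}(C,p)$ for the minimum of $p$ over $C$. The initial symbolic state is $(\ell_0,\{w=\vec 0\}^{\nearrow}\cap I(\ell_0))$, and the successors of $(\ell,C)$ are the $(\ell',C')$ with $C'=([C\cap g]_R\cap I(\ell'))^{\nearrow}\cap I(\ell')\neq\emptyset$ for an edge $(\ell,g,a,R,\ell')$.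 The algorithm starts with the waiting set $W$ containing only the initial symbolic state, the passed set $S=\emptyset$, $\mathit{Opt}=\infty$ and $K=\emptyset$. While $W\ne\emptyset$, it picks any $s=(\ell,C)\in W$ and moves it from $W$ to $S$. If $\ell\in T$: if $\mathit{GetMin}(C,p)<\mathit{Opt}$, it sets $\mathit{Opt}:=\mathit{GetMin}(C,p)$ and $K:=C{\downarrow_P}$; else if $\mathit{GetMin}(C,p)=\mathit{Opt}$, it sets $K:=K\cup C{\downarrow_P}$. If $\ell\notin T$, it adds to $W$ all successors of $s$ that are not in $W\cup S$. Its result is $K$, together with the final $\mathit{Opt}$. **Proposition (synthesis for one-clock PTAs).** 1. There is a computable function which, given a PTA $\mathcal A$ with exactly one clock, a set $T$ of its locations and a parameter $p$, returns a finite list of polyhedra over $P$ (conjunctions of linear inequalities with integer coefficients) whose union is $\mathit{MinParamSynth}(\mathcal A,p,T)$. 2. For every PTA $\mathcal A$ with exactly one clock, every $T\subseteq L$ and every $p\in P$, the algorithm MinParamSynth terminates, whichever states are picked, and its result $K$ is a finite union of polyhedra. If, moreover, $\vec 0\models v(I(\ell_0))$ for every $v$ for which $v(I(\ell_0))$ is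 satisfiable, then on termination $\mathit{Opt}=\mathit{MinParamReach}(\mathcal A,p,T)$, the set $T$ is reachable in $v(\mathcal A)$ for every $v\in K$, and $$\mathit{MinParamSynth}(\mathcal A,p,T)=\{v\in K\mid v(p)=\mathit{Opt}\}$$ (which is empty if $\mathit{Opt}$ is $\infty$ or of the form $(c,>)$). -/

import Mathlib

open scoped NNReal NNRat

/-- The comparison symbols `<, ≤, =, ≥, >`. -/
inductive CmpSym
  | lt | le | eq | ge | gt
  deriving DecidableEq

namespace CmpSym

/-- `r.holds a b` is `a ⋈ b`. -/
def holds (r : CmpSym) (a b : ℝ) : Prop :=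
  match r with
  | lt => a < b
  | le => a ≤ b
  | eq => a = b
  | ge => a ≥ b
  | gt => a > b

/-- A numbering of the five symbols, used to make `CmpSym` a type of finite data. -/
def equivFin : CmpSym ≃ Fin 5 where
  toFun r := match r with
    | lt => 0
    | le => 1
    | eq => 2
    | ge => 3
    | gt => 4
  invFun i := match i with
    | 0 => lt
    | 1 => le
    | 2 => eq
    | 3 => ge
    | 4 => gt
  left_inv r := by cases r <;> rfl
  right_inv i := by fin_cases i <;> rfl

instance : Primcodable CmpSym := Primcodable.ofEquiv (Fin 5) equivFin

end CmpSym

/-- Clock valuations `X → ℝ≥0`, for the set of clocks `X = Fin nX`. -/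
abbrev ClockVal (nX : ℕ) : Type := Fin nX → ℝ≥0

/-- Parameter valuations `P → ℚ≥0`, for the set of parameters `P = Fin nP`. -/
abbrev ParamVal (nP : ℕ) : Type := Fin nP → ℚ≥0

/-- An atomic constraint `x ⋈ d` (with `d : ℕ`) or `x ⋈ p` (with `p` a parameter). -/
structure Atom (nX nP : ℕ) where
  clock : Fin nX
  rel : CmpSym
  bound : ℕ ⊕ Fin nP

/-- `w ⊨ v(x ⋈ b)`. -/
def Atom.sat {nX nP : ℕ} (a : Atom nX nP) (w : ClockVal nX) (v : ParamVal nP) : Prop :=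
  a.rel.holds (w a.clock : ℝ) (Sum.elim (fun d : ℕ => (d : ℝ)) (fun p => ((v p : ℚ) : ℝ)) a.bound)

/-- A guard is a (possibly empty) conjunction of atomic constraints. -/
abbrev Guard (nX nP : ℕ) : Type := List (Atom nX nP)

/-- `w ⊨ v(g)`. -/
def Guard.sat {nX nP : ℕ} (g : Guard nX nP) (w : ClockVal nX) (v : ParamVal nP) : Prop :=
  ∀ a ∈ g, a.sat w v

/-- An edge `(ℓ, g, a, R, ℓ')`. -/
structure Edge (nA nL nX nP : ℕ) where
  src : Fin nL
  guard : Guard nX nP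
  act : Fin nA
  resets : Finset (Fin nX)
  tgt : Fin nL

/-- Parametric timed automata with `nA` actions, `nL` locations, `nX` clocks and `nP` parameters.
The finite set of edges is given by a list of its elements. -/
structure PTA (nA nL nX nP : ℕ) where
  init : Fin nL
  inv : Fin nL → Guard nX nP
  edges : List (Edge nA nL nX nP)

/-! ### Minima -/

/-- Minima: `⊤` is `∞`, and a pair `(c, b)` stands for `(c, =)` if `b = false` and for `(c, >)` if
`b = true`. The order is the lexicographic one, so `(c, =) < (c, >) < (c', =) < ∞` for `c < c'`. -/
abbrev Minimum : Type := WithTop (ℝ ×ₗ Bool)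

/-- The minimum `(c, =)`. -/
noncomputable def Minimum.attained (c : ℝ) : Minimum := ((toLex (c, false) : ℝ ×ₗ Bool) : Minimum)

/-- The minimum `(c, >)`. -/
noncomputable def Minimum.above (c : ℝ) : Minimum := ((toLex (c, true) : ℝ ×ₗ Bool) : Minimum)

open Classical in
/-- The minimum of a set of nonnegative reals: `∞` for the empty set, otherwise the infimum together
with the information whether it belongs to the set. -/
noncomputable def minimumOf (S : Set ℝ) : Minimum :=
  if S = ∅ then ⊤ else if sInf S ∈ S then Minimum.attained (sInf S) else Minimum.above (sInf S)

/-! ### Polyhedra over the parameters -/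

/-- An inequality `∑ᵢ cᵢ pᵢ + d ⋈ 0` with integer coefficients, as the triple `([c₀, c₁, …], d, ⋈)`;
coefficients beyond the end of the list are `0`. -/
abbrev LinIneq : Type := List ℤ × ℤ × CmpSym

/-- Satisfaction of a linear inequality by a valuation of `nP` parameters. -/
def LinIneq.sat {nP : ℕ} (i : LinIneq) (v : ParamVal nP) : Prop :=
  i.2.2.holds ((∑ j : Fin nP, ((i.1.getD j 0 : ℤ) : ℝ) * ((v j : ℚ) : ℝ)) + ((i.2.1 : ℤ) : ℝ)) 0

/-- A convex polyhedron: a conjunction of linear inequalities. -/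
abbrev Polyhedron : Type := List LinIneq

/-- A finite union of polyhedra. -/
abbrev PolyhedraUnion : Type := List Polyhedron

/-- The parameter valuations that belong to a finite union of polyhedra. -/
def PolyhedraUnion.toSet (nP : ℕ) (L : PolyhedraUnion) : Set (ParamVal nP) :=
  {v | ∃ C ∈ L, ∀ i ∈ C, LinIneq.sat i v}

/-! ### Finite descriptions of automata -/

/-- Description of a guard by plain data. -/
abbrev GuardCode : Type := List (ℕ × CmpSym × (ℕ ⊕ ℕ))

/-- Description of an edge by plain data: source, guard, action, reset flags, target. -/
abbrev EdgeCode : Type := ℕ × GuardCode × ℕ × List Bool × ℕ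

/-- Description of a PTA by plain data: numbers of actions, locations, clocks and parameters, the
initial location, the list of invariants and the list of edges. -/
abbrev PTACode : Type := (ℕ × ℕ × ℕ × ℕ) × ℕ × List GuardCode × List EdgeCode

/-- The characteristic list of a finite subset of `Fin n`. -/
def finsetCode {n : ℕ} (S : Finset (Fin n)) : List Bool := List.ofFn fun i => decide (i ∈ S)

/-- The description of a guard. -/
def Guard.code {nX nP : ℕ} (g : Guard nX nP) : GuardCode :=
  g.map fun a => ((a.clock : ℕ), a.rel, a.bound.map id (fun p => (p : ℕ)))

/-- The description of an edge. -/
def Edge.code {nA nL nX nP : ℕ} (e : Edge nA nL nX nP) : EdgeCode :=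
  ((e.src : ℕ), Guard.code e.guard, (e.act : ℕ), finsetCode e.resets, (e.tgt : ℕ))

/-- The description of a PTA. -/
def PTA.code {nA nL nX nP : ℕ} (A : PTA nA nL nX nP) : PTACode :=
  ((nA, nL, nX, nP), (A.init : ℕ), List.ofFn (fun l => Guard.code (A.inv l)), A.edges.map Edge.code)

namespace PTA

variable {nA nL nX nP : ℕ}

/-! ### Concrete semantics -/

/-- The reset of the clocks in `R`. -/
def reset (w : ClockVal nX) (R : Finset (Fin nX)) : ClockVal nX :=
  fun x => if x ∈ R then 0 else w x

/-- The delay `w + d`. -/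
def delay (w : ClockVal nX) (d : ℝ≥0) : ClockVal nX := fun x => w x + d

/-- The set of concrete states of `v(A)`. -/
def states (A : PTA nA nL nX nP) (v : ParamVal nP) : Set (Fin nL × ClockVal nX) :=
  {s | (A.inv s.1).sat s.2 v}

/-- Delay transitions of `v(A)`. -/
def DelayStep (A : PTA nA nL nX nP) (v : ParamVal nP) (d : ℝ≥0) (s s' : Fin nL × ClockVal nX) :
    Prop :=
  s' = (s.1, delay s.2 d) ∧ ∀ d' : ℝ≥0, d' ≤ d → (s.1, delay s.2 d') ∈ A.states v

/-- Discrete transitions of `v(A)`. -/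
def DiscreteStep (A : PTA nA nL nX nP) (v : ParamVal nP) (e : Edge nA nL nX nP)
    (s s' : Fin nL × ClockVal nX) : Prop :=
  e ∈ A.edges ∧ s ∈ A.states v ∧ s' ∈ A.states v ∧ s.1 = e.src ∧ s'.1 = e.tgt ∧
    e.guard.sat s.2 v ∧ s'.2 = reset s.2 e.resets

/-- The finite runs of `v(A)` that end in a given state: sequences `s₀, (d₀, e₀), s₁, …` of concrete
states from the initial one, in which each pair is a delay followed by a discrete transition. -/
inductive Run (A : PTA nA nL nX nP) (v : ParamVal nP) : Fin nL × ClockVal nX → Type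
  | start : (A.init, (0 : ClockVal nX)) ∈ A.states v → Run A v (A.init, 0)
  | step {s s'' s' : Fin nL × ClockVal nX} (d : ℝ≥0) (e : Edge nA nL nX nP) :
      Run A v s → A.DelayStep v d s s'' → A.DiscreteStep v e s'' s' → Run A v s'

/-- `Reach(v(A), T)`: the finite runs of `v(A)` that reach a location of `T`. -/
def Reach (A : PTA nA nL nX nP) (v : ParamVal nP) (T : Finset (Fin nL)) :
    Set (Σ s : Fin nL × ClockVal nX, A.Run v s) :=
  {ρ | ρ.1.1 ∈ T}

/-- The minimal value of the parameter `p` over the valuations for which `T` is reachable. -/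
noncomputable def minParamReach (A : PTA nA nL nX nP) (p : Fin nP) (T : Finset (Fin nL)) :
    Minimum :=
  minimumOf {c | ∃ v : ParamVal nP, (A.Reach v T).Nonempty ∧ c = ((v p : ℚ) : ℝ)}

/-- The valuations for which `T` is reachable and `p` has its minimal value. -/
def minParamSynth (A : PTA nA nL nX nP) (p : Fin nP) (T : Finset (Fin nL)) : Set (ParamVal nP) :=
  {v | (A.Reach v T).Nonempty ∧ Minimum.attained ((v p : ℚ) : ℝ) = A.minParamReach p T}

/-! ### Symbolic semantics -/

/-- Parametric zones, identified with the sets of valuations of clocks and parameters that satisfy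
them. -/
abbrev Zone (nX nP : ℕ) : Type := Set (ClockVal nX × ParamVal nP)

/-- The zone of a guard. -/
def guardZone (g : Guard nX nP) : Zone nX nP := {u | g.sat u.1 u.2}

/-- Time elapsing. -/
def elapse (C : Zone nX nP) : Zone nX nP := {u | ∃ w, ∃ d : ℝ≥0, (w, u.2) ∈ C ∧ u.1 = delay w d}

/-- The reset of a zone. -/
def resetZone (C : Zone nX nP) (R : Finset (Fin nX)) : Zone nX nP :=
  {u | ∃ w, (w, u.2) ∈ C ∧ u.1 = reset w R}

/-- The projection onto the parameters. -/
def proj (C : Zone nX nP) : Set (ParamVal nP) := {v | ∃ w, (w, v) ∈ C}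

/-- `GetMin(C, p)`. -/
noncomputable def getMin (C : Zone nX nP) (p : Fin nP) : Minimum :=
  minimumOf {c | ∃ u ∈ C, c = ((u.2 p : ℚ) : ℝ)}

/-- Symbolic states. -/
abbrev SymState (nL nX nP : ℕ) : Type := Fin nL × Zone nX nP

/-- The initial symbolic state. -/
def symInit (A : PTA nA nL nX nP) : SymState nL nX nP :=
  (A.init, elapse {u | u.1 = 0} ∩ guardZone (A.inv A.init))

/-- The zone that is obtained from `C` along the edge `e`. -/
def succZone (A : PTA nA nL nX nP) (C : Zone nX nP) (e : Edge nA nL nX nP) : Zone nX nP :=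
  elapse (resetZone (C ∩ guardZone e.guard) e.resets ∩ guardZone (A.inv e.tgt)) ∩
    guardZone (A.inv e.tgt)

/-- The successors of a symbolic state in the parametric zone graph. -/
def Succ (A : PTA nA nL nX nP) (s : SymState nL nX nP) : Set (SymState nL nX nP) :=
  {s' | ∃ e ∈ A.edges, e.src = s.1 ∧ s' = (e.tgt, A.succZone s.2 e) ∧ (A.succZone s.2 e).Nonempty}

/-! ### The algorithm -/

/-- The variables of the algorithm: waiting set, passed set, current optimum and current optimal
valuations. -/
structure Config (nL nX nP : ℕ) where
  W : Set (SymState nL nX nP)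
  P : Set (SymState nL nX nP)
  Opt : Minimum
  K : Set (ParamVal nP)

/-- The initialization. -/
def initConfig (A : PTA nA nL nX nP) : Config nL nX nP where
  W := {A.symInit}
  P := ∅
  Opt := ⊤
  K := ∅

open Classical in
/-- The body of the main loop, for the picked symbolic state `s`. -/
noncomputable def loopBody (A : PTA nA nL nX nP) (T : Finset (Fin nL)) (p : Fin nP)
    (c : Config nL nX nP) (s : SymState nL nX nP) : Config nL nX nP :=
  let W := c.W \ {s}
  let P := c.P ∪ {s}
  if s.1 ∈ T then
    if getMin s.2 p < c.Opt then ⟨W, P, getMin s.2 p, proj s.2⟩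
    else if getMin s.2 p = c.Opt then ⟨W, P, c.Opt, c.K ∪ proj s.2⟩
    else ⟨W, P, c.Opt, c.K⟩
  else ⟨W ∪ {s' ∈ A.Succ s | s' ∉ W ∧ s' ∉ P}, P, c.Opt, c.K⟩

/-- One iteration of the main loop, with an arbitrary choice of the picked state. -/
def Iter (A : PTA nA nL nX nP) (T : Finset (Fin nL)) (p : Fin nP) (c c' : Config nL nX nP) : Prop :=
  ∃ s ∈ c.W, c' = A.loopBody T p c s

/-- `MinParamSynth(A, T, p)` terminates: whatever states are picked, the main loop is not iterated
forever. -/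
def Terminates (A : PTA nA nL nX nP) (T : Finset (Fin nL)) (p : Fin nP) : Prop :=
  ¬ ∃ r : ℕ → Config nL nX nP, r 0 = A.initConfig ∧ ∀ n, A.Iter T p (r n) (r (n + 1))

/-- `c` is a final configuration of an execution of `MinParamSynth(A, T, p)`; `c.K` is its output. -/
def IsFinal (A : PTA nA nL nX nP) (T : Finset (Fin nL)) (p : Fin nP) (c : Config nL nX nP) : Prop :=
  Relation.ReflTransGen (A.Iter T p) A.initConfig c ∧ c.W = ∅

/-- The initial invariant does not exclude the initial state: for every valuation of the parameters
under which the invariant of the initial location is satisfiable at all, it holds when all clocks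
are `0`. -/
def InitAdmissible (A : PTA nA nL nX nP) : Prop :=
  ∀ (v : ParamVal nP) (w : ClockVal nX), (A.init, w) ∈ A.states v →
    (A.init, (0 : ClockVal nX)) ∈ A.states v

end PTA

/-! With a single clock, only order matters. A delay is an arbitrary increase of the clock
(`exists_delay_eq_iff`), a reset sets it to `0`, and guards compare it with parameters and with
constants up to some `M`. Hence a strictly increasing map of the line that fixes `0, …, M` carries
runs to runs, although it distorts durations (`reach_nonempty_of_stretch`), and all zones of the
zone graph are invariant under such maps. Two finite families of reals in the same order are related
by a strictly increasing map (`exists_strictMono_comp_eq`). Invariant sets are therefore unions of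
order-type classes, of which there are finitely many, and each class of parameter valuations is a
polyhedron.

The algorithm terminates because there are only finitely many invariant zones and each iteration
passes a new symbolic state. Its result is a union of projections of invariant zones, hence of
polyhedra. Correctness combines soundness of the zone graph (`SymReachable.exists_run`), its
completeness even though target states are not expanded (`IsFinal.exists_mem_proj`), and the
description of minima as greatest lower bounds (`isGLB_minimumOf`).

For computability, every order type is realized on a finite grid of step `1 / (n + 1)`, where `n` is
the number of parameters (`exists_gridVector`), and there reachability is a search in a finite graph
(`reach_code_iff`). It remains to decide whether the infimum of `p` is attained: a value that is not
one of `0, …, M` can be decreased (`exists_reach_lt`), so an attained minimum is one of these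
constants, and comparison with them is decided by the order type (`toSet_synth`). -/

/-! ### Strictly monotone maps that realize an order type -/

/-- Two finite families of reals with the same order type are related by a strictly monotone
function. -/
theorem exists_strictMono_comp_eq {ι : Type*} [Finite ι] (f g : ι → ℝ)
    (h : ∀ i j, f i < f j ↔ g i < g j) : ∃ φ : ℝ → ℝ, StrictMono φ ∧ ∀ i, φ (f i) = g i := by
  -- A slope `ε` so small that `g - ε f` is still nondecreasing along `f`. Only this difference has
  -- to be extended monotonically.
  have hev : ∀ᶠ ε in nhdsWithin (0 : ℝ) (Set.Ioi 0), ∀ q : ι × ι, f q.1 < f q.2 →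
      ε * (f q.2 - f q.1) ≤ g q.2 - g q.1 := by
    refine Filter.eventually_all.2 fun q => ?_
    by_cases hq : f q.1 < f q.2
    · have hg : 0 < g q.2 - g q.1 := sub_pos.2 ((h _ _).1 hq)
      have ht : Filter.Tendsto (fun ε : ℝ => ε * (f q.2 - f q.1)) (nhdsWithin 0 (Set.Ioi 0))
          (nhds 0) := by
        have : Continuous fun ε : ℝ => ε * (f q.2 - f q.1) := by fun_prop
        simpa using (this.tendsto 0).mono_left nhdsWithin_le_nhds
      filter_upwards [ht.eventually (gt_mem_nhds hg)] with ε hε _ using hε.le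
    · exact Filter.Eventually.of_forall fun ε h' => absurd h' hq
  obtain ⟨ε, hε, hpos⟩ := (hev.and self_mem_nhdsWithin).exists
  replace hpos : 0 < ε := hpos
  have hfac : Function.FactorsThrough g f := by
    intro i j hij
    have h1 := h i j
    have h2 := h j i
    rw [hij] at h1 h2
    simp only [lt_irrefl, false_iff, not_lt] at h1 h2
    exact le_antisymm h2 h1
  set F : ℝ → ℝ := fun x => Function.extend f g 0 x - ε * x with hF
  have hFf : ∀ i, F (f i) = g i - ε * f i := fun i => by
    simp only [hF, hfac.extend_apply]
  have hmono : MonotoneOn F (Set.range f) := by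
    rintro _ ⟨i, rfl⟩ _ ⟨j, rfl⟩ hij
    rcases hij.lt_or_eq with hlt | heq
    · rw [hFf, hFf]
      have := hε (i, j) hlt
      simp only at this
      linarith
    · rw [heq]
  have hfin : (F '' Set.range f).Finite := (Set.finite_range f).image F
  -- The extension `H` need not be strictly monotone; adding the slope `ε` back makes it so.
  obtain ⟨H, hH, hEq⟩ := hmono.exists_monotone_extension hfin.bddBelow hfin.bddAbove
  refine ⟨fun x => H x + ε * x, fun x y hxy => ?_, fun i => ?_⟩
  · have := hH hxy.le
    have := mul_lt_mul_of_pos_left hxy hpos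
    simp only
    linarith
  · have := hEq (Set.mem_range_self i)
    simp only
    rw [← this, hFf]
    ring

/-- Comparisons are invariant under strictly monotone functions. -/
theorem CmpSym.holds_strictMono {φ : ℝ → ℝ} (hφ : StrictMono φ) (r : CmpSym) (a b : ℝ) :
    r.holds (φ a) (φ b) ↔ r.holds a b := by
  cases r <;> simp [CmpSym.holds, hφ.lt_iff_lt, hφ.le_iff_le, hφ.injective.eq_iff]

/-- A comparison that holds at two points of the line holds between them. -/
theorem CmpSym.holds_of_mem_Icc {r : CmpSym} {a b c d : ℝ} (ha : r.holds a d) (hc : r.holds c d)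
    (hab : a ≤ b) (hbc : b ≤ c) : r.holds b d := by
  cases r <;> simp only [CmpSym.holds] at * <;> linarith

/-- Strictly monotone functions that fix the numbers `0, …, M`. -/
structure Stretch (M : ℕ) (φ : ℝ → ℝ) : Prop where
  strictMono : StrictMono φ
  map_nat : ∀ d : ℕ, d ≤ M → φ d = d

namespace Stretch

variable {M : ℕ} {φ : ℝ → ℝ}

theorem map_zero (hφ : Stretch M φ) : φ 0 = 0 := by
  simpa using hφ.map_nat 0 (Nat.zero_le M)

theorem nonneg (hφ : Stretch M φ) {x : ℝ} (hx : 0 ≤ x) : 0 ≤ φ x := by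
  simpa [hφ.map_zero] using hφ.strictMono.monotone hx

end Stretch

/-- The image of a clock valuation under a function on the reals. -/
noncomputable def ClockVal.map {nX : ℕ} (φ : ℝ → ℝ) (w : ClockVal nX) : ClockVal nX :=
  fun x => (φ (w x)).toNNReal

theorem ClockVal.coe_map {nX M : ℕ} {φ : ℝ → ℝ} (hφ : Stretch M φ) (w : ClockVal nX) (x : Fin nX) :
    (ClockVal.map φ w x : ℝ) = φ (w x) :=
  Real.coe_toNNReal _ (hφ.nonneg (w x).2)

/-- All constants of a guard are at most `M`. -/
def Guard.ConstsLe {nX nP : ℕ} (g : Guard nX nP) (M : ℕ) : Prop :=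
  ∀ a ∈ g, ∀ d, a.bound = Sum.inl d → d ≤ M

theorem Guard.sat_of_stretch {nX nP M : ℕ} {φ : ℝ → ℝ} (hφ : Stretch M φ) {g : Guard nX nP}
    (hg : g.ConstsLe M) {w w' : ClockVal nX} {v v' : ParamVal nP}
    (hw : ∀ x, (w' x : ℝ) = φ (w x)) (hv : ∀ i, ((v' i : ℚ) : ℝ) = φ ((v i : ℚ) : ℝ))
    (h : g.sat w v) : g.sat w' v' := by
  intro a ha
  have h1 := h a ha
  have h2 := hg a ha
  obtain ⟨x, r, b⟩ := a
  rcases b with d | i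
  · have hd := hφ.map_nat d (h2 d rfl)
    simp only [Atom.sat, Sum.elim_inl] at h1 ⊢
    rw [hw, ← hd, CmpSym.holds_strictMono hφ.strictMono]
    exact h1
  · simp only [Atom.sat, Sum.elim_inr] at h1 ⊢
    rw [hw, hv, CmpSym.holds_strictMono hφ.strictMono]
    exact h1

theorem Guard.sat_of_mem_Icc {nX nP : ℕ} {g : Guard nX nP} {w₁ w₂ w₃ : ClockVal nX}
    {v : ParamVal nP} (h₁ : g.sat w₁ v) (h₃ : g.sat w₃ v) (h₁₂ : w₁ ≤ w₂) (h₂₃ : w₂ ≤ w₃) :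
    g.sat w₂ v := fun a ha =>
  CmpSym.holds_of_mem_Icc (h₁ a ha) (h₃ a ha) (NNReal.coe_le_coe.2 (h₁₂ _))
    (NNReal.coe_le_coe.2 (h₂₃ _))

/-! ### Runs of one-clock automata and their invariance under strictly monotone maps. -/

namespace PTA

/-- All constants of an automaton are at most `M`. -/
def ConstsLe {nA nL nX nP : ℕ} (A : PTA nA nL nX nP) (M : ℕ) : Prop :=
  (∀ l, (A.inv l).ConstsLe M) ∧ ∀ e ∈ A.edges, e.guard.ConstsLe M

variable {nA nL nP : ℕ}

theorem clockVal_ext {w w' : ClockVal 1} (h : w 0 = w' 0) : w = w' :=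
  funext fun x => by rw [Subsingleton.elim x 0]; exact h

/-- The use of a single clock: with several clocks a delay preserves differences, which strictly
monotone maps do not respect, whereas `≤` is preserved. -/
theorem exists_delay_eq_iff {w w' : ClockVal 1} : (∃ d, w' = delay w d) ↔ w ≤ w' := by
  constructor
  · rintro ⟨d, rfl⟩
    exact fun x => le_self_add
  · intro h
    refine ⟨w' 0 - w 0, clockVal_ext ?_⟩
    simp only [delay]
    rw [add_tsub_cancel_of_le (h 0)]

/-- A delay followed by an edge, in an automaton with one clock. The value of the clock after the
delay is `y`. -/
def JointStep (A : PTA nA nL 1 nP) (v : ParamVal nP) (s s' : Fin nL × ClockVal 1) : Prop :=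
  ∃ e ∈ A.edges, ∃ y : ClockVal 1, s.1 = e.src ∧ s'.1 = e.tgt ∧ s.2 ≤ y ∧ (A.inv s.1).sat y v ∧
    e.guard.sat y v ∧ s'.2 = reset y e.resets ∧ (A.inv s'.1).sat s'.2 v

theorem Run.mem_states {A : PTA nA nL 1 nP} {v : ParamVal nP} {s : Fin nL × ClockVal 1}
    (ρ : A.Run v s) : s ∈ A.states v := by
  cases ρ with
  | start h => exact h
  | step d e ρ hd he => exact he.2.2.1

/-- Invariants are convex, so it suffices to check them at the two ends of a delay. The start of the
delay is a state because a run leads to it. -/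
theorem nonempty_run_iff {A : PTA nA nL 1 nP} {v : ParamVal nP} {s : Fin nL × ClockVal 1} :
    Nonempty (A.Run v s) ↔
      (A.init, 0) ∈ A.states v ∧ Relation.ReflTransGen (A.JointStep v) (A.init, 0) s := by
  constructor
  · rintro ⟨ρ⟩
    induction ρ with
    | start h => exact ⟨h, .refl⟩
    | @step s s'' s' d e ρ hd he ih =>
      refine ⟨ih.1, ih.2.tail ?_⟩
      obtain ⟨rfl, hinv⟩ := hd
      obtain ⟨h1, h2, h3, h4, h5, h6, h7⟩ := he
      exact ⟨e, h1, delay s.2 d, h4, h5, exists_delay_eq_iff.1 ⟨d, rfl⟩, h2, h6, h7, h3⟩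
  · rintro ⟨h0, h⟩
    induction h with
    | refl => exact ⟨.start h0⟩
    | @tail s s' _ hs ih =>
      obtain ⟨ρ⟩ := ih
      obtain ⟨e, h1, y, h2, h3, h4, h5, h6, h7, h8⟩ := hs
      obtain ⟨d, hd⟩ := exists_delay_eq_iff.2 h4
      refine ⟨.step (s'' := (s.1, y)) d e ρ ⟨by rw [hd], fun d' hd' => ?_⟩
        ⟨h1, h5, h8, h2, h3, h6, h7⟩⟩
      exact Guard.sat_of_mem_Icc ρ.mem_states h5 (exists_delay_eq_iff.1 ⟨d', rfl⟩)
        (by rw [hd]; exact fun x => add_le_add_right hd' _)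

theorem reach_nonempty_iff {A : PTA nA nL 1 nP} {v : ParamVal nP} {T : Finset (Fin nL)} :
    (A.Reach v T).Nonempty ↔ (A.init, 0) ∈ A.states v ∧
      ∃ s, s.1 ∈ T ∧ Relation.ReflTransGen (A.JointStep v) (A.init, 0) s := by
  constructor
  · rintro ⟨⟨s, ρ⟩, hs⟩
    obtain ⟨h1, h2⟩ := nonempty_run_iff.1 ⟨ρ⟩
    exact ⟨h1, s, hs, h2⟩
  · rintro ⟨h1, s, hs, h2⟩
    obtain ⟨ρ⟩ := nonempty_run_iff.2 ⟨h1, h2⟩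
    exact ⟨⟨s, ρ⟩, hs⟩

theorem map_reset {nX M : ℕ} {φ : ℝ → ℝ} (hφ : Stretch M φ) (w : ClockVal nX)
    (R : Finset (Fin nX)) : ClockVal.map φ (reset w R) = reset (ClockVal.map φ w) R := by
  funext x
  by_cases hx : x ∈ R <;> simp [ClockVal.map, reset, hx, hφ.map_zero]

theorem map_zero_clockVal {nX M : ℕ} {φ : ℝ → ℝ} (hφ : Stretch M φ) :
    ClockVal.map φ (0 : ClockVal nX) = 0 := by
  funext x
  simp [ClockVal.map, hφ.map_zero]

theorem map_mono {nX M : ℕ} {φ : ℝ → ℝ} (hφ : Stretch M φ) {w w' : ClockVal nX} (h : w ≤ w') :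
    ClockVal.map φ w ≤ ClockVal.map φ w' := fun x =>
  Real.toNNReal_le_toNNReal (hφ.strictMono.monotone (NNReal.coe_le_coe.2 (h x)))

/-- Reachability is invariant under strictly monotone functions that fix the constants. -/
theorem reach_nonempty_of_stretch {A : PTA nA nL 1 nP} {M : ℕ} (hA : A.ConstsLe M) {φ : ℝ → ℝ}
    (hφ : Stretch M φ) {v v' : ParamVal nP} (hv : ∀ i, ((v' i : ℚ) : ℝ) = φ ((v i : ℚ) : ℝ))
    {T : Finset (Fin nL)} (h : (A.Reach v T).Nonempty) : (A.Reach v' T).Nonempty := by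
  rw [reach_nonempty_iff] at h ⊢
  obtain ⟨h0, s, hs, h⟩ := h
  refine ⟨Guard.sat_of_stretch hφ (hA.1 _) (fun x => by simp [hφ.map_zero]) hv h0,
    (s.1, ClockVal.map φ s.2), hs, ?_⟩
  have := Relation.ReflTransGen.lift (p := A.JointStep v')
    (fun s : Fin nL × ClockVal 1 => (s.1, ClockVal.map φ s.2)) (fun a b hab => ?_) _ _ h
  · simpa only [Function.onFun, map_zero_clockVal hφ] using this
  · obtain ⟨e, h1, y, h2, h3, h4, h5, h6, h7, h8⟩ := hab
    refine ⟨e, h1, ClockVal.map φ y, h2, h3, map_mono hφ h4,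
      Guard.sat_of_stretch hφ (hA.1 _) (ClockVal.coe_map hφ y) hv h5,
      Guard.sat_of_stretch hφ (hA.2 e h1) (ClockVal.coe_map hφ y) hv h6, ?_,
      Guard.sat_of_stretch hφ (hA.1 _) (ClockVal.coe_map hφ _) hv h8⟩
    simp only [h7, map_reset hφ]

end PTA

/-! ### Minima as greatest lower bounds -/

/-- This replaces the case distinction in `minimumOf` by a universal property, so that minima can be
identified by uniqueness of greatest lower bounds. -/
theorem isGLB_minimumOf {S : Set ℝ} (hS : BddBelow S) :
    IsGLB (Minimum.attained '' S) (minimumOf S) := by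
  unfold minimumOf
  split_ifs with h0 h1
  · subst h0
    simp
  · refine IsLeast.isGLB ⟨⟨_, h1, rfl⟩, ?_⟩
    rintro _ ⟨x, hx, rfl⟩
    refine WithTop.coe_le_coe.2 (Prod.Lex.le_iff.2 ?_)
    rcases (csInf_le hS hx).lt_or_eq with h | h
    · exact Or.inl h
    · exact Or.inr ⟨h, le_rfl⟩
  · constructor
    · rintro _ ⟨x, hx, rfl⟩
      refine WithTop.coe_le_coe.2 (Prod.Lex.le_iff.2 (Or.inl ?_))
      exact (csInf_le hS hx).lt_of_ne fun h => h1 (h ▸ hx)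
    · intro b hb
      obtain ⟨x₀, hx₀⟩ := Set.nonempty_iff_ne_empty.2 h0
      have hb' : ∀ x ∈ S, b ≤ Minimum.attained x := fun x hx => hb ⟨x, hx, rfl⟩
      induction b using WithTop.recTopCoe with
      | top => exact absurd (hb' x₀ hx₀) (not_le.2 (WithTop.coe_lt_top _))
      | coe d =>
        refine WithTop.coe_le_coe.2 (Prod.Lex.le_iff.2 ?_)
        have hle : (ofLex d).1 ≤ sInf S := by
          refine le_csInf ⟨x₀, hx₀⟩ fun x hx => ?_
          rcases Prod.Lex.le_iff.1 (WithTop.coe_le_coe.1 (hb' x hx)) with h | h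
          · exact h.le
          · exact h.1.le
        rcases hle.lt_or_eq with h | h
        · exact Or.inl h
        -- `(sInf S, >)` is the largest pair with first component `sInf S`.
        · exact Or.inr ⟨h, Bool.le_true _⟩

theorem Minimum.attained_le_attained {a b : ℝ} :
    Minimum.attained a ≤ Minimum.attained b ↔ a ≤ b := by
  unfold Minimum.attained
  rw [WithTop.coe_le_coe, Prod.Lex.le_iff]
  exact ⟨fun h => h.elim (fun h => le_of_lt h) (fun h => h.1.le),
    fun h => h.lt_or_eq.imp id fun h => ⟨h, le_rfl⟩⟩

namespace PTA

section

variable {nA nL nX nP : ℕ}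

theorem bddBelow_paramVal {ι : Type*} (q : ι → Prop) (v : ι → ParamVal nP) (p : Fin nP) :
    BddBelow {c : ℝ | ∃ i, q i ∧ c = ((v i p : ℚ) : ℝ)} := by
  refine ⟨0, ?_⟩
  rintro _ ⟨i, -, rfl⟩
  exact_mod_cast (v i p).2

theorem isGLB_getMin (C : Zone nX nP) (p : Fin nP) :
    IsGLB {m | ∃ u ∈ C, m = Minimum.attained ((u.2 p : ℚ) : ℝ)} (getMin C p) := by
  convert isGLB_minimumOf (bddBelow_paramVal (· ∈ C) (fun u => u.2) p) using 1
  · ext m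
    simp only [Set.mem_ofPred_eq, Set.mem_image]
    constructor
    · rintro ⟨u, hu, rfl⟩
      exact ⟨_, ⟨u, hu, rfl⟩, rfl⟩
    · rintro ⟨_, ⟨u, hu, rfl⟩, rfl⟩
      exact ⟨u, hu, rfl⟩
  · rfl

theorem isGLB_minParamReach (A : PTA nA nL nX nP) (p : Fin nP) (T : Finset (Fin nL)) :
    IsGLB {m | ∃ v, (A.Reach v T).Nonempty ∧ m = Minimum.attained ((v p : ℚ) : ℝ)}
      (A.minParamReach p T) := by
  convert isGLB_minimumOf
    (bddBelow_paramVal (fun v : ParamVal nP => (A.Reach v T).Nonempty) id p) using 1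
  · ext m
    simp only [Set.mem_ofPred_eq, Set.mem_image]
    constructor
    · rintro ⟨v, hv, rfl⟩
      exact ⟨_, ⟨v, hv, rfl⟩, rfl⟩
    · rintro ⟨_, ⟨v, hv, rfl⟩, rfl⟩
      exact ⟨v, hv, rfl⟩
  · rfl

/-- A greatest lower bound that equals the value of a member is a least element, so `∞` and `(c, >)`
no longer have to be considered. -/
theorem mem_minParamSynth_iff {A : PTA nA nL nX nP} {p : Fin nP} {T : Finset (Fin nL)}
    {v : ParamVal nP} : v ∈ A.minParamSynth p T ↔
      (A.Reach v T).Nonempty ∧ ∀ v', (A.Reach v' T).Nonempty → v p ≤ v' p := by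
  have hglb := A.isGLB_minParamReach p T
  refine and_congr_right fun hv => ⟨fun h v' hv' => ?_, fun h => ?_⟩
  · have : A.minParamReach p T ≤ Minimum.attained ((v' p : ℚ) : ℝ) := hglb.1 ⟨v', hv', rfl⟩
    rw [← h, Minimum.attained_le_attained] at this
    exact_mod_cast this
  · refine (hglb.unique (IsLeast.isGLB ⟨⟨v, hv, rfl⟩, ?_⟩)).symm
    rintro _ ⟨v', hv', rfl⟩
    rw [Minimum.attained_le_attained]
    exact_mod_cast h v' hv'

end

variable {nA nL nP : ℕ}

/-! ### Zones that are determined by order types -/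

/-- Zones that are invariant under strictly monotone functions fixing `0, …, M`. -/
def ZoneInvariant {nX : ℕ} (M : ℕ) (C : Zone nX nP) : Prop :=
  ∀ φ, Stretch M φ → ∀ u t : ClockVal nX × ParamVal nP, (∀ x, (t.1 x : ℝ) = φ (u.1 x)) →
    (∀ i, ((t.2 i : ℚ) : ℝ) = φ ((u.2 i : ℚ) : ℝ)) → u ∈ C → t ∈ C

/-- Sets of parameter valuations that are invariant under strictly monotone functions fixing
`0, …, M`. -/
def ParamInvariant (M : ℕ) (K : Set (ParamVal nP)) : Prop :=
  ∀ φ, Stretch M φ → ∀ v v' : ParamVal nP,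
    (∀ i, ((v' i : ℚ) : ℝ) = φ ((v i : ℚ) : ℝ)) → v ∈ K → v' ∈ K

section

variable {nX M : ℕ}

theorem ZoneInvariant.inter {C D : Zone nX nP} (hC : ZoneInvariant M C) (hD : ZoneInvariant M D) :
    ZoneInvariant M (C ∩ D) := fun φ hφ u u' h1 h2 h =>
  ⟨hC φ hφ u u' h1 h2 h.1, hD φ hφ u u' h1 h2 h.2⟩

theorem zoneInvariant_guardZone {g : Guard nX nP} (hg : g.ConstsLe M) :
    ZoneInvariant M (guardZone g) := fun _ hφ _ _ h1 h2 h =>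
  Guard.sat_of_stretch hφ hg h1 h2 h

theorem ZoneInvariant.resetZone {C : Zone nX nP} (hC : ZoneInvariant M C) (R : Finset (Fin nX)) :
    ZoneInvariant M (resetZone C R) := by
  rintro φ hφ u u' h1 h2 ⟨w, hw, hu⟩
  refine ⟨ClockVal.map φ w, hC φ hφ (w, u.2) _ (ClockVal.coe_map hφ w) h2 hw, ?_⟩
  rw [← map_reset hφ, ← hu]
  exact funext fun x => NNReal.coe_injective ((h1 x).trans (ClockVal.coe_map hφ _ x).symm)

theorem ZoneInvariant.proj {C : Zone nX nP} (hC : ZoneInvariant M C) :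
    ParamInvariant M (proj C) := by
  rintro φ hφ v v' hv ⟨w, hw⟩
  exact ⟨ClockVal.map φ w, hC φ hφ (w, v) _ (ClockVal.coe_map hφ w) hv hw⟩

end

theorem mem_elapse_iff {C : Zone 1 nP} {u : ClockVal 1 × ParamVal nP} :
    u ∈ elapse C ↔ ∃ w ≤ u.1, (w, u.2) ∈ C := by
  constructor
  · rintro ⟨w, d, hw, hd⟩
    exact ⟨w, exists_delay_eq_iff.1 ⟨d, hd⟩, hw⟩
  · rintro ⟨w, hle, hw⟩
    obtain ⟨d, hd⟩ := exists_delay_eq_iff.2 hle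
    exact ⟨w, d, hw, hd⟩

/-- The only zone operation that depends on having one clock: the earlier point is moved by the same
map, which keeps it earlier. -/
theorem ZoneInvariant.elapse {M : ℕ} {C : Zone 1 nP} (hC : ZoneInvariant M C) :
    ZoneInvariant M (elapse C) := by
  intro φ hφ u u' h1 h2 hu
  rw [mem_elapse_iff] at hu ⊢
  obtain ⟨w, hle, hw⟩ := hu
  refine ⟨ClockVal.map φ w, fun x => ?_, hC φ hφ (w, u.2) _ (ClockVal.coe_map hφ w) h2 hw⟩
  rw [← NNReal.coe_le_coe, ClockVal.coe_map hφ, h1]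
  exact hφ.strictMono.monotone (NNReal.coe_le_coe.2 (hle x))

theorem ZoneInvariant.succZone {A : PTA nA nL 1 nP} {M : ℕ} (hA : A.ConstsLe M) {C : Zone 1 nP}
    (hC : ZoneInvariant M C) {e : Edge nA nL 1 nP} (he : e ∈ A.edges) :
    ZoneInvariant M (A.succZone C e) :=
  have hI := zoneInvariant_guardZone (hA.1 e.tgt)
  ((((hC.inter (zoneInvariant_guardZone (hA.2 e he))).resetZone _).inter hI).elapse).inter hI

theorem zoneInvariant_symInit {A : PTA nA nL 1 nP} {M : ℕ} (hA : A.ConstsLe M) :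
    ZoneInvariant M A.symInit.2 := by
  refine ZoneInvariant.inter (ZoneInvariant.elapse ?_) (zoneInvariant_guardZone (hA.1 _))
  intro φ hφ u u' h1 _ h
  simp only [Set.mem_ofPred_eq] at h ⊢
  funext x
  have := h1 x
  rw [h] at this
  exact NNReal.coe_injective (by simpa [hφ.map_zero] using this)

/-- The order type of the clocks, the parameters and the constants `0, …, M`. -/
def orderType {nX : ℕ} (M : ℕ) (u : ClockVal nX × ParamVal nP) :
    (Fin nX ⊕ Fin nP ⊕ Fin (M + 1)) → (Fin nX ⊕ Fin nP ⊕ Fin (M + 1)) → Prop :=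
  let pt : (Fin nX ⊕ Fin nP ⊕ Fin (M + 1)) → ℝ :=
    Sum.elim (fun x => u.1 x) (Sum.elim (fun i => ((u.2 i : ℚ) : ℝ)) (fun d => ((d : ℕ) : ℝ)))
  fun a b => pt a < pt b

theorem ZoneInvariant.mem_of_orderType_eq {nX M : ℕ} {C : Zone nX nP} (hC : ZoneInvariant M C)
    {u u' : ClockVal nX × ParamVal nP} (h : orderType M u = orderType M u') (hu : u ∈ C) :
    u' ∈ C := by
  obtain ⟨φ, hφ, hφ'⟩ := exists_strictMono_comp_eq _ _
    fun a b => iff_of_eq (congrFun (congrFun h a) b)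
  refine hC φ ⟨hφ, fun d hd => ?_⟩ u u' (fun x => ?_) (fun i => ?_) hu
  · exact hφ' (Sum.inr (Sum.inr ⟨d, Nat.lt_succ_of_le hd⟩))
  · exact (hφ' (Sum.inl x)).symm
  · exact (hφ' (Sum.inr (Sum.inl i))).symm

/-- An invariant zone is the union of the order-type classes that it meets, and order types are
relations on a fixed finite type. -/
theorem finite_setOf_zoneInvariant (nX nP M : ℕ) : {C : Zone nX nP | ZoneInvariant M C}.Finite := by
  refine Set.Finite.of_finite_image (f := fun C => orderType M '' C) (Set.toFinite _) ?_
  have key : ∀ C D : Zone nX nP, ZoneInvariant M D → orderType M '' C = orderType M '' D →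
      C ⊆ D := by
    intro C D hD h u hu
    obtain ⟨u', hu', h'⟩ : orderType M u ∈ orderType M '' D := h ▸ Set.mem_image_of_mem _ hu
    exact hD.mem_of_orderType_eq h' hu'
  intro C hC D hD h
  exact (key C D hD h).antisymm (key D C hC h.symm)

/-! ### The parametric zone graph -/

/-- The symbolic states that are reachable in the parametric zone graph. -/
inductive SymReachable {nX : ℕ} (A : PTA nA nL nX nP) : SymState nL nX nP → Prop
  | init : SymReachable A A.symInit
  | succ {s s' : SymState nL nX nP} : SymReachable A s → s' ∈ A.Succ s → SymReachable A s'

theorem SymReachable.zoneInvariant {A : PTA nA nL 1 nP} {M : ℕ} (hA : A.ConstsLe M)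
    {s : SymState nL 1 nP} (hs : A.SymReachable s) : ZoneInvariant M s.2 := by
  induction hs with
  | init => exact zoneInvariant_symInit hA
  | succ _ hs' ih =>
    obtain ⟨e, he, -, rfl, -⟩ := hs'
    exact ih.succZone hA he

/-- Every point of a reachable zone is obtained by a run followed by a delay. -/
theorem SymReachable.exists_run {A : PTA nA nL 1 nP} (hadm : A.InitAdmissible)
    {s : SymState nL 1 nP} (hs : A.SymReachable s) : ∀ u ∈ s.2, (A.inv s.1).sat u.1 u.2 ∧
      (A.init, 0) ∈ A.states u.2 ∧
      ∃ w ≤ u.1, Relation.ReflTransGen (A.JointStep u.2) (A.init, 0) (s.1, w) := by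
  induction hs with
  | init =>
    rintro u ⟨-, hu⟩
    -- The initial zone imposes the invariant only after time has elapsed; admissibility provides it
    -- at clock value `0`.
    exact ⟨hu, hadm u.2 u.1 hu, 0, fun x => zero_le, .refl⟩
  | @succ s s' _ hs' ih =>
    obtain ⟨e, he, hsrc, rfl, -⟩ := hs'
    rintro u ⟨hu, hI⟩
    obtain ⟨w', hle, ⟨w, ⟨hw, hg⟩, hreset⟩, htgt⟩ := mem_elapse_iff.1 hu
    obtain ⟨h1, h2, w₀, h3, h4⟩ := ih _ hw
    exact ⟨hI, h2, w', hle, h4.tail ⟨e, he, w, hsrc.symm, rfl, h3, h1, hg, hreset, htgt⟩⟩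

/-! ### The loop invariant -/

/-- The invariant of the main loop. -/
structure LoopInv {nX : ℕ} (A : PTA nA nL nX nP) (T : Finset (Fin nL)) (p : Fin nP)
    (c : Config nL nX nP) : Prop where
  reachable : ∀ s ∈ c.W ∪ c.P, A.SymReachable s
  disjoint : ∀ s ∈ c.W, s ∉ c.P
  init_mem : A.symInit ∈ c.W ∪ c.P
  closed : ∀ s ∈ c.P, s.1 ∉ T → A.Succ s ⊆ c.W ∪ c.P
  opt_le : ∀ s ∈ c.P, s.1 ∈ T → c.Opt ≤ getMin s.2 p
  opt_mem : c.Opt = ⊤ ∨ ∃ s ∈ c.P, s.1 ∈ T ∧ c.Opt = getMin s.2 p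
  K_eq : c.K = {v | ∃ s ∈ c.P, s.1 ∈ T ∧ getMin s.2 p = c.Opt ∧ v ∈ proj s.2}

theorem loopInv_init {nX : ℕ} (A : PTA nA nL nX nP) (T : Finset (Fin nL)) (p : Fin nP) :
    A.LoopInv T p A.initConfig where
  reachable := by
    rintro s (hs | hs)
    · rw [show s = A.symInit from hs]
      exact .init
    · exact hs.elim
  disjoint _ _ h := h
  init_mem := Or.inl rfl
  closed _ h := h.elim
  opt_le _ h := h.elim
  opt_mem := Or.inl rfl
  K_eq := by simp [initConfig]

theorem loopBody_P {nX : ℕ} (A : PTA nA nL nX nP) (T : Finset (Fin nL)) (p : Fin nP)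
    (c : Config nL nX nP) (s : SymState nL nX nP) : (A.loopBody T p c s).P = c.P ∪ {s} := by
  unfold loopBody
  split_ifs <;> rfl

theorem LoopInv.loopBody {nX : ℕ} {A : PTA nA nL nX nP} {T : Finset (Fin nL)} {p : Fin nP}
    {c : Config nL nX nP} (h : A.LoopInv T p c) {s : SymState nL nX nP} (hs : s ∈ c.W) :
    A.LoopInv T p (A.loopBody T p c s) := by
  have hWP : (c.W \ {s}) ∪ (c.P ∪ {s}) = c.W ∪ c.P := by
    ext t
    by_cases ht : t = s
    · subst ht; simp [hs]
    · simp [ht]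
  have hdisj : ∀ t ∈ c.W \ {s}, t ∉ c.P ∪ {s} := by
    rintro t ⟨ht, hts⟩ (ht' | ht')
    · exact h.disjoint t ht ht'
    · exact hts ht'
  unfold PTA.loopBody
  simp only
  split_ifs with hT h1 h2
  · have hclosed : ∀ t ∈ c.P ∪ {s}, t.1 ∉ T → A.Succ t ⊆ (c.W \ {s}) ∪ (c.P ∪ {s}) := by
      rw [hWP]
      rintro t (ht | rfl) htT
      · exact h.closed t ht htT
      · exact absurd hT htT
    refine ⟨by simpa only [hWP] using h.reachable, hdisj, by simpa only [hWP] using h.init_mem,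
      hclosed, ?_, Or.inr ⟨s, Or.inr rfl, hT, rfl⟩, ?_⟩
    · rintro t (ht | rfl) htT
      · exact h1.le.trans (h.opt_le t ht htT)
      · exact le_rfl
    · ext v
      constructor
      · exact fun hv => ⟨s, Or.inr rfl, hT, rfl, hv⟩
      · rintro ⟨t, ht | rfl, htT, hm, hv⟩
        -- Target states passed before have a minimum of at least the old optimum, so none of them
        -- attains the new one and the old `K` may be dropped.
        · exact absurd (h.opt_le t ht htT) (not_le.2 (hm ▸ h1))
        · exact hv
  · have hclosed : ∀ t ∈ c.P ∪ {s}, t.1 ∉ T → A.Succ t ⊆ (c.W \ {s}) ∪ (c.P ∪ {s}) := by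
      rw [hWP]
      rintro t (ht | rfl) htT
      · exact h.closed t ht htT
      · exact absurd hT htT
    refine ⟨by simpa only [hWP] using h.reachable, hdisj, by simpa only [hWP] using h.init_mem,
      hclosed, ?_, Or.inr ⟨s, Or.inr rfl, hT, h2.symm⟩, ?_⟩
    · rintro t (ht | rfl) htT
      · exact h.opt_le t ht htT
      · exact h2.ge
    · ext v
      simp only [h.K_eq]
      constructor
      · rintro (⟨t, ht, htT, hm, hv⟩ | hv)
        · exact ⟨t, Or.inl ht, htT, hm, hv⟩
        · exact ⟨s, Or.inr rfl, hT, h2, hv⟩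
      · rintro ⟨t, ht | rfl, htT, hm, hv⟩
        · exact Or.inl ⟨t, ht, htT, hm, hv⟩
        · exact Or.inr hv
  · have hclosed : ∀ t ∈ c.P ∪ {s}, t.1 ∉ T → A.Succ t ⊆ (c.W \ {s}) ∪ (c.P ∪ {s}) := by
      rw [hWP]
      rintro t (ht | rfl) htT
      · exact h.closed t ht htT
      · exact absurd hT htT
    refine ⟨by simpa only [hWP] using h.reachable, hdisj, by simpa only [hWP] using h.init_mem,
      hclosed, ?_, ?_, ?_⟩
    · rintro t (ht | rfl) htT
      · exact h.opt_le t ht htT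
      · exact not_lt.1 h1
    · exact h.opt_mem.imp id fun ⟨t, ht, ht'⟩ => ⟨t, Or.inl ht, ht'⟩
    · ext v
      simp only [h.K_eq]
      constructor
      · rintro ⟨t, ht, ht'⟩
        exact ⟨t, Or.inl ht, ht'⟩
      · rintro ⟨t, ht | rfl, htT, hm, hv⟩
        · exact ⟨t, ht, htT, hm, hv⟩
        · exact absurd hm h2
  · have hsub : ∀ t ∈ c.W ∪ c.P, t ∈ (c.W \ {s} ∪
        {s' ∈ A.Succ s | s' ∉ c.W \ {s} ∧ s' ∉ c.P ∪ {s}}) ∪ (c.P ∪ {s}) := by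
      rw [← hWP]
      rintro t (ht | ht)
      · exact Or.inl (Or.inl ht)
      · exact Or.inr ht
    refine ⟨?_, ?_, hsub _ h.init_mem, ?_, ?_, ?_, ?_⟩
    · rintro t ((ht | ht) | ht)
      · exact h.reachable t (Or.inl ht.1)
      · exact .succ (h.reachable s (Or.inl hs)) ht.1
      · exact h.reachable t (hWP ▸ Or.inr ht)
    · rintro t (ht | ht)
      · exact hdisj t ht
      · exact ht.2.2
    · rintro t (ht | rfl) htT
      · exact (h.closed t ht htT).trans hsub
      · intro t' ht'
        by_cases h' : t' ∈ (c.W \ {t}) ∪ (c.P ∪ {t})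
        · exact hsub _ (hWP ▸ h')
        · exact Or.inl (Or.inr ⟨ht', fun h => h' (Or.inl h), fun h => h' (Or.inr h)⟩)
    · rintro t (ht | rfl) htT
      · exact h.opt_le t ht htT
      · exact absurd htT hT
    · exact h.opt_mem.imp id fun ⟨t, ht, ht'⟩ => ⟨t, Or.inl ht, ht'⟩
    · ext v
      simp only [h.K_eq]
      constructor
      · rintro ⟨t, ht, ht'⟩
        exact ⟨t, Or.inl ht, ht'⟩
      · rintro ⟨t, ht | rfl, htT, hm, hv⟩
        · exact ⟨t, ht, htT, hm, hv⟩
        · exact absurd htT hT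

theorem LoopInv.iter {nX : ℕ} {A : PTA nA nL nX nP} {T : Finset (Fin nL)} {p : Fin nP}
    {c c' : Config nL nX nP} (h : A.LoopInv T p c) (hc : A.Iter T p c c') : A.LoopInv T p c' := by
  obtain ⟨s, hs, rfl⟩ := hc
  exact h.loopBody hs

theorem IsFinal.loopInv {nX : ℕ} {A : PTA nA nL nX nP} {T : Finset (Fin nL)} {p : Fin nP}
    {c : Config nL nX nP} (hc : A.IsFinal T p c) : A.LoopInv T p c := by
  obtain ⟨h, -⟩ := hc
  induction h with
  | refl => exact A.loopInv_init T p
  | tail _ h ih => exact ih.iter h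

/-! ### Termination and correctness of the algorithm -/

/-- The picked state was not passed before, so the passed sets grow strictly; yet all of them
consist of locations paired with invariant zones, a finite supply. -/
theorem terminates_of_constsLe {A : PTA nA nL 1 nP} {M : ℕ} (hA : A.ConstsLe M)
    (T : Finset (Fin nL)) (p : Fin nP) : A.Terminates T p := by
  rintro ⟨r, h0, hr⟩
  have hinv : ∀ n, A.LoopInv T p (r n) := fun n => by
    induction n with
    | zero => exact h0 ▸ A.loopInv_init T p
    | succ n ih => exact ih.iter (hr n)
  have hlt : ∀ n, (r n).P ⊂ (r (n + 1)).P := fun n => by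
    obtain ⟨s, hs, h⟩ := hr n
    rw [h, loopBody_P, Set.ssubset_iff_of_subset Set.subset_union_left]
    exact ⟨s, Or.inr rfl, (hinv n).disjoint s hs⟩
  have hmono : StrictMono fun n => (r n).P := strictMono_nat_of_lt_succ hlt
  have hfin : {s : SymState nL 1 nP | ZoneInvariant M s.2}.Finite :=
    (Set.finite_univ.prod (finite_setOf_zoneInvariant 1 nP M)).subset fun s hs =>
      ⟨Set.mem_univ _, hs⟩
  refine Set.infinite_range_of_injective hmono.injective (hfin.finite_subsets.subset ?_)
  rintro _ ⟨n, rfl⟩ s hs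
  exact ((hinv n).reachable s (Or.inr hs)).zoneInvariant hA

/-- Whether a zone contributes to `c.K` depends on its `getMin`, not on the valuation, so `c.K` is a
union of entire projections of invariant zones. -/
theorem IsFinal.paramInvariant {A : PTA nA nL 1 nP} {M : ℕ} (hA : A.ConstsLe M)
    {T : Finset (Fin nL)} {p : Fin nP} {c : Config nL 1 nP} (hc : A.IsFinal T p c) :
    ParamInvariant M c.K := by
  have h := hc.loopInv
  intro φ hφ v v' hv hvK
  rw [h.K_eq] at hvK ⊢
  obtain ⟨s, hs, hsT, hm, hvs⟩ := hvK
  exact ⟨s, hs, hsT, hm, ((h.reachable s (Or.inr hs)).zoneInvariant hA).proj φ hφ _ _ hv hvs⟩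

/-- On termination, the zones with a location in `T` cover all valuations for which `T` is
reachable. -/
theorem IsFinal.exists_mem_proj {A : PTA nA nL 1 nP} {T : Finset (Fin nL)} {p : Fin nP}
    {c : Config nL 1 nP} (hc : A.IsFinal T p c) {v : ParamVal nP} (hv : (A.Reach v T).Nonempty) :
    ∃ s ∈ c.P, s.1 ∈ T ∧ v ∈ proj s.2 := by
  have h := hc.loopInv
  have hWP : c.W ∪ c.P = c.P := by rw [hc.2, Set.empty_union]
  obtain ⟨h0, s, hs, hreach⟩ := reach_nonempty_iff.1 hv
  -- Target states are not expanded, so the run need not be followed to its end. If no passed target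
  -- zone contains `v`, however, no state on the way is a target and each one is expanded.
  by_contra hno
  -- The induction needs a zone that also contains all later clock values allowed by the invariant,
  -- since the next joint step begins with a delay.
  obtain ⟨C, hC, hmem⟩ : ∃ C, (s.1, C) ∈ c.P ∧ (s.2, v) ∈ C ∧
      ∀ w, s.2 ≤ w → (A.inv s.1).sat w v → (w, v) ∈ C := by
    clear hs
    induction hreach with
    | refl =>
      have hmem : ∀ w : ClockVal 1, 0 ≤ w → (A.inv A.init).sat w v → (w, v) ∈ A.symInit.2 :=
        fun w hw hI => ⟨mem_elapse_iff.2 ⟨0, hw, rfl⟩, hI⟩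
      exact ⟨A.symInit.2, hWP ▸ h.init_mem, hmem 0 le_rfl h0, hmem⟩
    | @tail a b _ hab ih =>
      obtain ⟨C, hC, haC, hmem⟩ := ih
      obtain ⟨e, he, y, h1, h2, h3, h4, h5, h6, h7⟩ := hab
      have haT : a.1 ∉ T := fun haT => hno ⟨_, hC, haT, a.2, haC⟩
      rw [h2] at h7 ⊢
      have hmem' : ∀ w : ClockVal 1, b.2 ≤ w → (A.inv e.tgt).sat w v →
          (w, v) ∈ A.succZone C e := fun w hw hI =>
        ⟨mem_elapse_iff.2 ⟨b.2, hw, ⟨y, ⟨hmem y h3 h4, h5⟩, h6⟩, h7⟩, hI⟩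
      have hb := hmem' b.2 le_rfl h7
      refine ⟨A.succZone C e, hWP ▸ h.closed _ hC haT ⟨e, he, h1.symm, rfl, _, hb⟩, hb, hmem'⟩
  exact hno ⟨_, hC, hs, s.2, hmem.1⟩

theorem IsFinal.reach_nonempty {A : PTA nA nL 1 nP} (hadm : A.InitAdmissible)
    {T : Finset (Fin nL)} {p : Fin nP} {c : Config nL 1 nP} (hc : A.IsFinal T p c)
    {s : SymState nL 1 nP} (hs : s ∈ c.P) (hsT : s.1 ∈ T) {v : ParamVal nP} (hv : v ∈ proj s.2) :
    (A.Reach v T).Nonempty := by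
  obtain ⟨w, hw⟩ := hv
  obtain ⟨-, h0, w₀, -, hr⟩ := (hc.loopInv.reachable s (Or.inr hs)).exists_run hadm _ hw
  exact reach_nonempty_iff.2 ⟨h0, _, hsT, hr⟩

/-- Lower bound: each reaching valuation lies in a passed target zone. Greatest: a finite `Opt` is
the minimum of one such zone, all of whose valuations reach `T`. -/
theorem IsFinal.opt_eq {A : PTA nA nL 1 nP} (hadm : A.InitAdmissible)
    {T : Finset (Fin nL)} {p : Fin nP} {c : Config nL 1 nP} (hc : A.IsFinal T p c) :
    c.Opt = A.minParamReach p T := by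
  refine IsGLB.unique ⟨?_, fun b hb => ?_⟩ (A.isGLB_minParamReach p T)
  · rintro _ ⟨v, hv, rfl⟩
    obtain ⟨s, hs, hsT, w, hw⟩ := hc.exists_mem_proj hv
    exact (hc.loopInv.opt_le s hs hsT).trans ((isGLB_getMin s.2 p).1 ⟨_, hw, rfl⟩)
  · rcases hc.loopInv.opt_mem with h | ⟨s, hs, hsT, h⟩
    · exact h ▸ le_top
    · rw [h]
      refine (isGLB_getMin s.2 p).2 ?_
      rintro _ ⟨u, hu, rfl⟩
      exact hb ⟨u.2, hc.reach_nonempty hadm hs hsT ⟨u.1, hu⟩, rfl⟩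

theorem IsFinal.reach_nonempty_of_mem_K {A : PTA nA nL 1 nP} (hadm : A.InitAdmissible)
    {T : Finset (Fin nL)} {p : Fin nP} {c : Config nL 1 nP} (hc : A.IsFinal T p c)
    {v : ParamVal nP} (hv : v ∈ c.K) : (A.Reach v T).Nonempty := by
  rw [hc.loopInv.K_eq] at hv
  obtain ⟨s, hs, hsT, -, hv⟩ := hv
  exact hc.reach_nonempty hadm hs hsT hv

/-- A target zone containing a reaching `v` with `v p = Opt` has minimum at most `v p` and at least
`Opt`, so its projection is part of `c.K`. -/
theorem IsFinal.minParamSynth_eq {A : PTA nA nL 1 nP} (hadm : A.InitAdmissible)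
    {T : Finset (Fin nL)} {p : Fin nP} {c : Config nL 1 nP} (hc : A.IsFinal T p c) :
    A.minParamSynth p T = {v ∈ c.K | Minimum.attained ((v p : ℚ) : ℝ) = c.Opt} := by
  have hopt := hc.opt_eq hadm
  ext v
  simp only [minParamSynth, Set.mem_ofPred_eq, ← hopt]
  refine and_congr_left fun hvp => ⟨fun hv => ?_, hc.reach_nonempty_of_mem_K hadm⟩
  obtain ⟨s, hs, hsT, w, hw⟩ := hc.exists_mem_proj hv
  rw [hc.loopInv.K_eq]
  refine ⟨s, hs, hsT, le_antisymm ?_ (hc.loopInv.opt_le s hs hsT), w, hw⟩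
  exact hvp ▸ (isGLB_getMin s.2 p).1 ⟨_, hw, rfl⟩

end PTA

/-! ### Polyhedra of order types -/

/-- The comparison symbol between two natural numbers. -/
def CmpSym.between (a b : ℕ) : CmpSym := if a < b then .lt else if a = b then .eq else .gt

theorem CmpSym.holds_between_iff {a b : ℕ} {x y : ℝ} :
    (CmpSym.between a b).holds x y ↔ (x < y ↔ a < b) ∧ (y < x ↔ b < a) := by
  unfold CmpSym.between
  split_ifs with h1 h2
  · simp only [CmpSym.holds, h1, h1.not_gt, iff_true, iff_false, not_lt]
    exact ⟨fun h => ⟨h, h.le⟩, fun h => h.1⟩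
  · subst h2
    simp only [CmpSym.holds, lt_irrefl, iff_false, not_lt]
    exact ⟨fun h => ⟨h.ge, h.le⟩, fun h => le_antisymm h.2 h.1⟩
  · have h3 : b < a := by omega
    simp only [CmpSym.holds, h1, h3, iff_true, iff_false, not_lt]
    exact ⟨fun h => ⟨h.le, h⟩, fun h => h.2⟩

/-- The coefficients of the difference of the `i`-th and the `j`-th of `n` variables; the variables
with index at least `n` are read as `0`. -/
def diffCoeffs (n i j : ℕ) : List ℤ :=
  (List.range n).map fun k => (if k = i then 1 else 0) - (if k = j then 1 else 0)

/-- The `i`-th point of the family that consists of the values `u / (n + 1)` of the `n` parameters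
and of the constants `0, 1, …`, multiplied by `n + 1`. -/
def gridPoint (n : ℕ) (u : List ℕ) (i : ℕ) : ℕ := u.getD i 0 + (i - n) * (n + 1)

/-- The polyhedron of the valuations for which the parameters and the constants `0, …, M` are
ordered as for the valuation `u / (n + 1)`. -/
def orderPolyhedron (n M : ℕ) (u : List ℕ) : Polyhedron :=
  (List.range (n + M + 1)).flatMap fun i => (List.range (n + M + 1)).map fun j =>
    (diffCoeffs n i j, ((i - n : ℕ) : ℤ) - ((j - n : ℕ) : ℤ),
      CmpSym.between (gridPoint n u i) (gridPoint n u j))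

namespace ParamVal

variable {n : ℕ}

/-- The family that consists of the values of the parameters and of the constants `0, 1, …`. -/
noncomputable def point (v : ParamVal n) (i : ℕ) : ℝ :=
  (if h : i < n then ((v ⟨i, h⟩ : ℚ) : ℝ) else 0) + ((i - n : ℕ) : ℝ)

theorem point_fin (v : ParamVal n) (i : Fin n) : v.point i = ((v i : ℚ) : ℝ) := by
  have : (i : ℕ) - n = 0 := by omega
  simp [point, this]

theorem point_const (v : ParamVal n) (d : ℕ) : v.point (n + d) = d := by
  simp [point]

theorem sum_indicator_mul (v : ParamVal n) (i : ℕ) :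
    ∑ k : Fin n, (if (k : ℕ) = i then (1 : ℝ) else 0) * ((v k : ℚ) : ℝ) =
      if h : i < n then ((v ⟨i, h⟩ : ℚ) : ℝ) else 0 := by
  split_ifs with h
  · rw [Finset.sum_eq_single ⟨i, h⟩]
    · simp
    · intro k _ hk
      rw [if_neg fun h' => hk (Fin.ext h'), zero_mul]
    · simp
  · refine Finset.sum_eq_zero fun k _ => ?_
    rw [if_neg (by omega), zero_mul]

theorem sum_diffCoeffs_mul (v : ParamVal n) (i j : ℕ) :
    (∑ k : Fin n, (((diffCoeffs n i j).getD k 0 : ℤ) : ℝ) * ((v k : ℚ) : ℝ)) +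
      ((((i - n : ℕ) : ℤ) - ((j - n : ℕ) : ℤ) : ℤ) : ℝ) = v.point i - v.point j := by
  have h : ∀ k : Fin n, (((diffCoeffs n i j).getD k 0 : ℤ) : ℝ) * ((v k : ℚ) : ℝ) =
      (if (k : ℕ) = i then (1 : ℝ) else 0) * ((v k : ℚ) : ℝ) -
      (if (k : ℕ) = j then (1 : ℝ) else 0) * ((v k : ℚ) : ℝ) := by
    intro k
    rw [← sub_mul]
    congr 1
    simp [diffCoeffs, List.getD_eq_getElem?_getD]
  simp only [h, Finset.sum_sub_distrib, sum_indicator_mul, point]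
  push_cast
  ring

/-- Two valuations induce the same order on the parameters and the constants `0, …, M`. -/
def OrderEquiv (M : ℕ) (v v' : ParamVal n) : Prop :=
  ∀ i < n + M + 1, ∀ j < n + M + 1, v.point i < v.point j ↔ v'.point i < v'.point j

theorem OrderEquiv.symm {M : ℕ} {v v' : ParamVal n} (h : OrderEquiv M v v') : OrderEquiv M v' v :=
  fun i hi j hj => (h i hi j hj).symm

theorem OrderEquiv.exists_stretch {M : ℕ} {v v' : ParamVal n} (h : OrderEquiv M v v') :
    ∃ φ, Stretch M φ ∧ ∀ i, ((v' i : ℚ) : ℝ) = φ ((v i : ℚ) : ℝ) := by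
  obtain ⟨φ, hφ, hφ'⟩ := exists_strictMono_comp_eq (fun i : Fin (n + M + 1) => v.point i)
    (fun i => v'.point i) fun i j => h i i.2 j j.2
  refine ⟨φ, ⟨hφ, fun d hd => ?_⟩, fun i => ?_⟩
  · simpa only [point_const] using hφ' ⟨n + d, by omega⟩
  · simpa only [point_fin] using (hφ' ⟨i, by omega⟩).symm

theorem OrderEquiv.const_le_iff {M : ℕ} {v v' : ParamVal n} (h : OrderEquiv M v v') (i : Fin n)
    {d : ℕ} (hd : d ≤ M) : (d : ℝ) ≤ ((v i : ℚ) : ℝ) ↔ (d : ℝ) ≤ ((v' i : ℚ) : ℝ) := by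
  have := h i (by omega) (n + d) (by omega)
  simp only [point_const, point_fin] at this
  rw [← not_lt, this, not_lt]

theorem OrderEquiv.le_const_iff {M : ℕ} {v v' : ParamVal n} (h : OrderEquiv M v v') (i : Fin n)
    {d : ℕ} (hd : d ≤ M) : ((v i : ℚ) : ℝ) ≤ d ↔ ((v' i : ℚ) : ℝ) ≤ d := by
  have := h (n + d) (by omega) i (by omega)
  simp only [point_const, point_fin] at this
  rw [← not_lt, this, not_lt]

/-- The valuation `u / (n + 1)`. -/
def ofGrid (n : ℕ) (u : List ℕ) : ParamVal n := fun i => (u.getD i 0 : ℚ≥0) / (n + 1)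

theorem coe_ofGrid (n : ℕ) (u : List ℕ) (i : Fin n) :
    ((ofGrid n u i : ℚ) : ℝ) = (u.getD i 0 : ℝ) / (n + 1) := by
  simp [ofGrid]

theorem point_ofGrid {u : List ℕ} (hu : u.length = n) (i : ℕ) :
    (ofGrid n u).point i = (gridPoint n u i : ℝ) / (n + 1) := by
  have hn : (n : ℝ) + 1 ≠ 0 := by positivity
  unfold point gridPoint
  split_ifs with h
  · rw [coe_ofGrid]
    have : i - n = 0 := by omega
    simp [this]
  · have : u.getD i 0 = 0 := by
      rw [List.getD_eq_getElem?_getD, List.getElem?_eq_none (by omega), Option.getD_none]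
    rw [this]
    push_cast
    field_simp
    ring

theorem sat_orderPolyhedron_iff (M : ℕ) (u : List ℕ) (v : ParamVal n) :
    (∀ q ∈ orderPolyhedron n M u, LinIneq.sat q v) ↔
      ∀ i < n + M + 1, ∀ j < n + M + 1,
        (v.point i < v.point j ↔ gridPoint n u i < gridPoint n u j) := by
  have key : ∀ i j, LinIneq.sat (diffCoeffs n i j, ((i - n : ℕ) : ℤ) - ((j - n : ℕ) : ℤ),
      CmpSym.between (gridPoint n u i) (gridPoint n u j)) v ↔
      (v.point i < v.point j ↔ gridPoint n u i < gridPoint n u j) ∧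
      (v.point j < v.point i ↔ gridPoint n u j < gridPoint n u i) := by
    intro i j
    unfold LinIneq.sat
    simp only
    rw [sum_diffCoeffs_mul, CmpSym.holds_between_iff, sub_neg, sub_pos]
  simp only [orderPolyhedron, List.mem_flatMap, List.mem_map, List.mem_range]
  constructor
  · intro h i hi j hj
    exact ((key i j).1 (h _ ⟨i, hi, j, hj, rfl⟩)).1
  · rintro h _ ⟨i, hi, j, hj, rfl⟩
    exact (key i j).2 ⟨h i hi j hj, h j hj i hi⟩

theorem sat_orderPolyhedron_iff_orderEquiv (M : ℕ) {u : List ℕ} (hu : u.length = n)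
    (v : ParamVal n) :
    (∀ q ∈ orderPolyhedron n M u, LinIneq.sat q v) ↔ OrderEquiv M v (ofGrid n u) := by
  rw [sat_orderPolyhedron_iff]
  have hn : (0 : ℝ) < (n : ℝ) + 1 := by positivity
  simp only [OrderEquiv, point_ofGrid hu, div_lt_div_iff_of_pos_right hn, Nat.cast_lt]

end ParamVal

/-! ### Every order type occurs on the grid. -/

/-- The lists of length `n` with entries at most `N`. -/
def gridVectors (N : ℕ) : ℕ → List (List ℕ)
  | 0 => [[]]
  | n + 1 => (gridVectors N n).flatMap fun u => (List.range (N + 1)).map fun k => k :: u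

theorem mem_gridVectors_iff {N n : ℕ} {u : List ℕ} :
    u ∈ gridVectors N n ↔ u.length = n ∧ ∀ k ∈ u, k ≤ N := by
  induction n generalizing u with
  | zero =>
    simp only [gridVectors, List.mem_singleton, List.length_eq_zero_iff]
    exact ⟨fun h => ⟨h, by simp [h]⟩, fun h => h.1⟩
  | succ n ih =>
    simp only [gridVectors, List.mem_flatMap, List.mem_map, List.mem_range, ih]
    constructor
    · rintro ⟨u, ⟨hu, hu'⟩, k, hk, rfl⟩
      refine ⟨by simp [hu], fun m hm => ?_⟩
      rcases List.mem_cons.1 hm with rfl | hm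
      · omega
      · exact hu' m hm
    · rintro ⟨hu, hu'⟩
      cases u with
      | nil => simp at hu
      | cons k u =>
        exact ⟨u, ⟨by simpa using hu, fun m hm => hu' m (List.mem_cons_of_mem _ hm)⟩, k,
          Nat.lt_succ_of_le (hu' k List.mem_cons_self), rfl⟩

namespace ParamVal

variable {n : ℕ}

open Classical in
/-- The position of `x` in the grid of step `1 / (n + 1)`: the integer part of `x`, truncated at
`M`, and the number of parameters between this number and `x`. -/
noncomputable def gridRank (M : ℕ) (v : ParamVal n) (x : ℝ) : ℕ :=
  min ⌊x⌋₊ M * (n + 1) +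
    (Finset.univ.filter fun k => ((min ⌊x⌋₊ M : ℕ) : ℝ) < ((v k : ℚ) : ℝ) ∧
      ((v k : ℚ) : ℝ) ≤ x).card

theorem gridRank_le (M : ℕ) (v : ParamVal n) (x : ℝ) :
    gridRank M v x ≤ min ⌊x⌋₊ M * (n + 1) + n :=
  Nat.add_le_add_left ((Finset.card_le_univ _).trans_eq (Fintype.card_fin n)) _

theorem gridRank_natCast {M d : ℕ} (v : ParamVal n) (hd : d ≤ M) :
    gridRank M v d = d * (n + 1) := by
  unfold gridRank
  rw [Nat.floor_natCast, min_eq_left hd, Finset.filter_false_of_mem, Finset.card_empty, add_zero]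
  exact fun k _ h => absurd h.1 (not_lt.2 h.2)

/-- If the truncated integer parts differ, they contribute a gap of `n + 1`, more than the count of
at most `n` parameters can make up. If they agree, the upper point cannot be a constant up to `M`,
so it is a parameter, counted for itself but not for `x`. -/
theorem gridRank_lt_gridRank {M : ℕ} (v : ParamVal n) {i : ℕ} (hi : i < n + M + 1) {x : ℝ}
    (hx : 0 ≤ x) (h : x < v.point i) : gridRank M v x < gridRank M v (v.point i) := by
  have hmono : min ⌊x⌋₊ M ≤ min ⌊v.point i⌋₊ M := min_le_min_right _ (Nat.floor_le_floor h.le)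
  rcases hmono.lt_or_eq with hlt | heq
  · calc gridRank M v x ≤ min ⌊x⌋₊ M * (n + 1) + n := gridRank_le M v x
      _ < (min ⌊x⌋₊ M + 1) * (n + 1) := by ring_nf; omega
      _ ≤ min ⌊v.point i⌋₊ M * (n + 1) := Nat.mul_le_mul_right _ hlt
      _ ≤ gridRank M v (v.point i) := Nat.le_add_right _ _
  · have hmx : ((min ⌊x⌋₊ M : ℕ) : ℝ) ≤ x :=
      (Nat.cast_le.2 (min_le_left _ _)).trans (Nat.floor_le hx)
    rcases lt_or_ge i n with hin | hin
    · have hp := v.point_fin ⟨i, hin⟩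
      simp only at hp
      unfold gridRank
      rw [← heq]
      refine Nat.add_lt_add_left (Finset.card_lt_card ?_) _
      rw [Finset.ssubset_iff_of_subset]
      · refine ⟨⟨i, hin⟩, ?_, ?_⟩
        · simp only [Finset.mem_filter, Finset.mem_univ, true_and, ← hp]
          exact ⟨hmx.trans_lt h, le_rfl⟩
        · simp only [Finset.mem_filter, Finset.mem_univ, true_and, ← hp, not_and, not_le]
          exact fun _ => h
      · intro k hk
        simp only [Finset.mem_filter, Finset.mem_univ, true_and] at hk ⊢
        exact ⟨hk.1, hk.2.trans h.le⟩
    · obtain ⟨d, rfl⟩ := Nat.exists_eq_add_of_le hin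
      rw [point_const] at heq h
      rw [Nat.floor_natCast, min_eq_left (show d ≤ M by omega)] at heq
      rw [heq] at hmx
      exact absurd h (not_lt.2 hmx)

theorem point_nonneg (v : ParamVal n) (i : ℕ) : 0 ≤ v.point i := by
  unfold point
  split_ifs with h
  · have : (0 : ℝ) ≤ ((v ⟨i, h⟩ : ℚ) : ℝ) := by exact_mod_cast (v ⟨i, h⟩).2
    positivity
  · positivity

/-- Every valuation has the same order type as a valuation in the grid. -/
theorem exists_gridVector (M : ℕ) (v : ParamVal n) :
    ∃ u ∈ gridVectors ((M + 1) * (n + 1)) n, OrderEquiv M v (ofGrid n u) := by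
  set u : List ℕ := List.ofFn fun k : Fin n => gridRank M v ((v k : ℚ) : ℝ) with hu
  have hlen : u.length = n := by simp [hu]
  refine ⟨u, mem_gridVectors_iff.2 ⟨hlen, ?_⟩, ?_⟩
  · intro k hk
    obtain ⟨i, rfl⟩ := (List.mem_ofFn' _ _).1 hk
    refine (gridRank_le M v _).trans ?_
    have : min ⌊((v i : ℚ) : ℝ)⌋₊ M * (n + 1) ≤ M * (n + 1) :=
      Nat.mul_le_mul_right _ (min_le_right _ _)
    ring_nf at this ⊢
    omega
  · rw [← sat_orderPolyhedron_iff_orderEquiv M hlen, sat_orderPolyhedron_iff]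
    have hpt : ∀ i < n + M + 1, gridPoint n u i = gridRank M v (v.point i) := by
      intro i hi
      unfold gridPoint
      rcases lt_or_ge i n with hin | hin
      · have hp := v.point_fin ⟨i, hin⟩
        simp only at hp
        rw [hp, Nat.sub_eq_zero_of_le hin.le]
        simp [hu, List.getD_eq_getElem?_getD, hin]
      · obtain ⟨d, rfl⟩ := Nat.exists_eq_add_of_le hin
        rw [point_const, gridRank_natCast v (by omega), List.getD_eq_getElem?_getD,
          List.getElem?_eq_none (by omega)]
        simp
    intro i hi j hj
    rw [hpt i hi, hpt j hj]
    constructor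
    · exact gridRank_lt_gridRank v hj (point_nonneg v i)
    · intro h
      by_contra hle
      rcases (not_lt.1 hle).lt_or_eq with h' | h'
      · exact h.asymm (gridRank_lt_gridRank v hi (point_nonneg v j) h')
      · rw [h'] at h
        exact lt_irrefl _ h

end ParamVal

open Classical in
/-- Invariant sets of parameter valuations are finite unions of polyhedra. -/
theorem PTA.ParamInvariant.exists_eq_toSet {n M : ℕ} {K : Set (ParamVal n)}
    (hK : PTA.ParamInvariant M K) : ∃ L : PolyhedraUnion, K = L.toSet n := by
  have hiff : ∀ v v' : ParamVal n, ParamVal.OrderEquiv M v v' → v ∈ K → v' ∈ K := by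
    intro v v' h hv
    obtain ⟨φ, hφ, hφ'⟩ := h.exists_stretch
    exact hK φ hφ v v' hφ' hv
  -- The grid meets every order type and `K` is a union of order types, so the classes of the grid
  -- valuations in `K` suffice.
  refine ⟨((gridVectors ((M + 1) * (n + 1)) n).filter fun u =>
    ParamVal.ofGrid n u ∈ K).map (orderPolyhedron n M), ?_⟩
  ext v
  simp only [PolyhedraUnion.toSet, Set.mem_ofPred_eq, List.mem_map, List.mem_filter,
    decide_eq_true_eq]
  constructor
  · intro hv
    obtain ⟨u, hu, huv⟩ := ParamVal.exists_gridVector M v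
    exact ⟨_, ⟨u, ⟨hu, hiff _ _ huv hv⟩, rfl⟩,
      (ParamVal.sat_orderPolyhedron_iff_orderEquiv M (mem_gridVectors_iff.1 hu).1 v).2 huv⟩
  · rintro ⟨_, ⟨u, ⟨hu, huK⟩, rfl⟩, hv⟩
    exact hiff _ _ ((ParamVal.sat_orderPolyhedron_iff_orderEquiv M
      (mem_gridVectors_iff.1 hu).1 v).1 hv).symm huK

/-! ### Reachability on descriptions of automata

For the parameter valuation `u / (n + 1)`, it suffices to consider the values `y / (2 (n + 1))` of
the clock, for natural numbers `y` up to a bound. -/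

/-- The value of a bound, multiplied by `2 (n + 1)`, for the valuation `u / (n + 1)`. -/
def boundCode (n : ℕ) (u : List ℕ) (b : ℕ ⊕ ℕ) : ℕ :=
  Sum.elim (fun d => 2 * (d * (n + 1))) (fun i => 2 * u.getD i 0) b

/-- Satisfaction of the guard `g` by the clock value `y / (2 (n + 1))` and the parameter valuation
`u / (n + 1)`. -/
def GuardCode.Sat (n : ℕ) (u : List ℕ) (g : GuardCode) (y : ℕ) : Prop :=
  ∀ a ∈ g, a.2.1.holds (y : ℝ) (boundCode n u a.2.2 : ℝ)

namespace PTACode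

/-- The number of parameters. -/
def numParams (c : PTACode) : ℕ := c.1.2.2.2

/-- The number of locations. -/
def numLocs (c : PTACode) : ℕ := c.1.2.1

/-- The invariant of a location. -/
def invCode (c : PTACode) (l : ℕ) : GuardCode := c.2.2.1.getD l []

/-- An upper bound for the constants of the automaton. -/
def maxConst (c : PTACode) : ℕ :=
  ((c.2.2.1.flatten ++ c.2.2.2.flatMap fun e => e.2.1).map
    fun a => Sum.elim id (fun _ => 0) a.2.2).foldr max 0

/-- The largest entry of the grid of parameter valuations. -/
def gridSize (c : PTACode) : ℕ := (c.maxConst + 1) * (c.numParams + 1)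

/-- A delay followed by an edge, on pairs of a location and a clock value. -/
def Step (c : PTACode) (u : List ℕ) (s t : ℕ × ℕ) : Prop :=
  ∃ e ∈ c.2.2.2, ∃ y ∈ List.range (2 * c.gridSize + 2), s.1 = e.1 ∧ t.1 = e.2.2.2.2 ∧
    t.1 < c.numLocs ∧ s.2 ≤ y ∧ (c.invCode s.1).Sat c.numParams u y ∧
    GuardCode.Sat c.numParams u e.2.1 y ∧ t.2 = (if e.2.2.2.1.getD 0 false = true then 0 else y) ∧
    (c.invCode t.1).Sat c.numParams u t.2

/-- The set `T` is reachable for the parameter valuation `u / (n + 1)`. -/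
def Reach (c : PTACode) (T : List Bool) (u : List ℕ) : Prop :=
  (c.invCode c.2.1).Sat c.numParams u 0 ∧ ∃ l ∈ List.range c.numLocs, T.getD l false = true ∧
    ∃ y ∈ List.range (2 * c.gridSize + 2), Relation.ReflTransGen (c.Step u) (c.2.1, 0) (l, y)

end PTACode

theorem List.le_foldr_max {l : List ℕ} {k : ℕ} (h : k ∈ l) : k ≤ l.foldr max 0 := by
  induction l with
  | nil => simp at h
  | cons m l ih =>
    rcases List.mem_cons.1 h with rfl | h
    · exact le_max_left _ _
    · exact (ih h).trans (le_max_right _ _)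

theorem getD_finsetCode {n : ℕ} (S : Finset (Fin n)) (i : Fin n) :
    (finsetCode S).getD i false = true ↔ i ∈ S := by
  simp [finsetCode, List.getD_eq_getElem?_getD]

/-! ### Simulation between real clock values and natural numbers. -/

namespace PTA

variable {nA nL nP : ℕ}

theorem invCode_code (A : PTA nA nL 1 nP) (l : Fin nL) :
    A.code.invCode l = Guard.code (A.inv l) := by
  simp [PTACode.invCode, PTA.code, List.getD_eq_getElem?_getD]

theorem constsLe_of_forall_mem_code {g : Guard 1 nP} {M : ℕ}
    (h : ∀ a ∈ Guard.code g, Sum.elim id (fun _ => 0) a.2.2 ≤ M) : g.ConstsLe M := by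
  intro a ha d hd
  have h' := h _ (List.mem_map_of_mem ha)
  obtain ⟨x, r, b⟩ := a
  obtain rfl : b = Sum.inl d := hd
  exact h'

theorem constsLe_maxConst (A : PTA nA nL 1 nP) : A.ConstsLe A.code.maxConst := by
  constructor
  · refine fun l => constsLe_of_forall_mem_code fun a ha => List.le_foldr_max ?_
    refine List.mem_map.2 ⟨a, List.mem_append_left _ (List.mem_flatten.2 ⟨_, ?_, ha⟩), rfl⟩
    exact (List.mem_ofFn' _ _).2 ⟨l, rfl⟩
  · refine fun e he => constsLe_of_forall_mem_code fun a ha => List.le_foldr_max ?_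
    refine List.mem_map.2 ⟨a, List.mem_append_right _ (List.mem_flatMap.2 ⟨e.code, ?_, ha⟩), rfl⟩
    exact List.mem_map_of_mem he

/-- Guards are satisfied by a clock value and a grid valuation if and only if their descriptions are
satisfied by a natural number with the same position in the grid. -/
theorem sat_code_iff {g : Guard 1 nP} {M N : ℕ} (hg : g.ConstsLe M) (hN : M * (nP + 1) ≤ N)
    {u : List ℕ} (hu : u ∈ gridVectors N nP) {w : ClockVal 1} {y : ℕ}
    (hy : ∀ k : ℕ, k ≤ N → ∀ r : CmpSym,
      (r.holds (y : ℝ) ((2 * k : ℕ) : ℝ) ↔ r.holds (w 0 : ℝ) ((k : ℝ) / (nP + 1)))) :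
    GuardCode.Sat nP u (Guard.code g) y ↔ g.sat w (ParamVal.ofGrid nP u) := by
  have hn : (nP : ℝ) + 1 ≠ 0 := by positivity
  simp only [GuardCode.Sat, Guard.code, Guard.sat, List.forall_mem_map]
  refine forall₂_congr fun a ha => ?_
  have h2 := hg a ha
  obtain ⟨x, r, b⟩ := a
  obtain rfl : x = 0 := Subsingleton.elim _ _
  rcases b with d | i
  · change r.holds (y : ℝ) ((2 * (d * (nP + 1)) : ℕ) : ℝ) ↔ r.holds (w 0 : ℝ) (d : ℝ)
    rw [hy _ ((Nat.mul_le_mul_right _ (h2 d rfl)).trans hN)]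
    push_cast
    rw [mul_div_cancel_right₀ _ hn]
  · change r.holds (y : ℝ) ((2 * u.getD i 0 : ℕ) : ℝ) ↔
      r.holds (w 0 : ℝ) ((ParamVal.ofGrid nP u i : ℚ) : ℝ)
    rw [hy, ParamVal.coe_ofGrid]
    obtain ⟨hlen, hle⟩ := mem_gridVectors_iff.1 hu
    have hi : (i : ℕ) < u.length := by omega
    rw [List.getD_eq_getElem?_getD, List.getElem?_eq_getElem hi, Option.getD_some]
    exact hle _ (List.getElem_mem hi)

/-- The clock value `y / (2 (n + 1))`. -/
noncomputable def clockOfNat (n y : ℕ) : ClockVal 1 := fun _ => (y : ℝ≥0) / (2 * (n + 1))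

theorem holds_clockOfNat_iff (n y k : ℕ) (r : CmpSym) :
    r.holds (y : ℝ) ((2 * k : ℕ) : ℝ) ↔ r.holds (clockOfNat n y 0 : ℝ) ((k : ℝ) / (n + 1)) := by
  have hn : (0 : ℝ) < 2 * (n + 1) := by positivity
  have hφ : StrictMono fun x : ℝ => x / (2 * (n + 1)) := fun a b hab =>
    div_lt_div_of_pos_right hab hn
  rw [← CmpSym.holds_strictMono hφ]
  have : ((2 * k : ℕ) : ℝ) / (2 * (n + 1)) = (k : ℝ) / (n + 1) := by
    push_cast
    rw [mul_div_mul_left _ _ two_ne_zero]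
  simp [clockOfNat, ← this]

/-- The position of a clock value in the grid of step `1 / (2 (n + 1))`, truncated at `2 N + 1`:
values strictly between multiples of `1 / (n + 1)` are moved to the middle. -/
noncomputable def clockRank (n N : ℕ) (w : ClockVal 1) : ℕ :=
  min (⌊w 0 * (n + 1)⌋₊ + ⌈w 0 * (n + 1)⌉₊) (2 * N + 1)

theorem clockRank_mono (n N : ℕ) {w w' : ClockVal 1} (h : w ≤ w') :
    clockRank n N w ≤ clockRank n N w' := by
  have : w 0 * (n + 1) ≤ w' 0 * (n + 1) := mul_le_mul_left (h 0) _
  exact min_le_min_right _ (add_le_add (Nat.floor_le_floor this) (Nat.ceil_le_ceil this))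

theorem clockRank_zero (n N : ℕ) : clockRank n N 0 = 0 := by
  simp [clockRank]

theorem clockRank_lt (n N : ℕ) (w : ClockVal 1) : clockRank n N w < 2 * N + 2 :=
  Nat.lt_succ_of_le (min_le_right _ _)

/-- With `x = w 0 * (n + 1)`, floor plus ceiling is `2 k` at `x = k` and `2 k + 1` strictly between
`k` and `k + 1`. The cap `2 N + 1` exceeds all the even numbers `2 k` with `k ≤ N`, so truncation
does not affect these comparisons. -/
theorem holds_clockRank_iff {n N : ℕ} (w : ClockVal 1) {k : ℕ} (hk : k ≤ N) (r : CmpSym) :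
    r.holds (clockRank n N w : ℝ) ((2 * k : ℕ) : ℝ) ↔ r.holds (w 0 : ℝ) ((k : ℝ) / (n + 1)) := by
  have hn : (0 : ℝ) < (n : ℝ) + 1 := by positivity
  set x : ℝ≥0 := w 0 * (n + 1) with hx
  have hxr : (x : ℝ) = w 0 * (n + 1) := by simp [hx]
  have hlt : clockRank n N w < 2 * k ↔ (w 0 : ℝ) < (k : ℝ) / (n + 1) := by
    rw [lt_div_iff₀ hn, ← hxr, ← NNReal.coe_natCast, NNReal.coe_lt_coe]
    have h1 : ⌊x⌋₊ < k ↔ x < k := Nat.floor_lt (zero_le)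
    have h2 : ⌈x⌉₊ ≤ k ↔ x ≤ k := Nat.ceil_le
    have h3 : k ≤ ⌊x⌋₊ ↔ (k : ℝ≥0) ≤ x := Nat.le_floor_iff (zero_le)
    have h4 := Nat.floor_le_ceil x
    unfold clockRank
    rw [← hx]
    constructor
    · intro h
      refine h1.1 ?_
      omega
    · intro h
      have := h1.2 h
      have := h2.2 h.le
      omega
  have hgt : 2 * k < clockRank n N w ↔ (k : ℝ) / (n + 1) < (w 0 : ℝ) := by
    rw [div_lt_iff₀ hn, ← hxr, ← NNReal.coe_natCast, NNReal.coe_lt_coe]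
    have h2 : k < ⌈x⌉₊ ↔ (k : ℝ≥0) < x := Nat.lt_ceil
    have h3 : k ≤ ⌊x⌋₊ ↔ (k : ℝ≥0) ≤ x := Nat.le_floor_iff (zero_le)
    have h4 := Nat.floor_le_ceil x
    unfold clockRank
    rw [← hx]
    constructor
    · intro h
      refine h2.1 ?_
      omega
    · intro h
      have := h2.2 h
      have := h3.2 h.le
      omega
  have hlt' : (clockRank n N w : ℝ) < ((2 * k : ℕ) : ℝ) ↔ (w 0 : ℝ) < (k : ℝ) / (n + 1) := by
    rw [Nat.cast_lt, hlt]
  have hgt' : ((2 * k : ℕ) : ℝ) < (clockRank n N w : ℝ) ↔ (k : ℝ) / (n + 1) < (w 0 : ℝ) := by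
    rw [Nat.cast_lt, hgt]
  cases r
  · exact hlt'
  · exact not_lt.symm.trans ((not_congr hgt').trans not_lt)
  · simp only [CmpSym.holds, le_antisymm_iff]
    exact and_congr (not_lt.symm.trans ((not_congr hgt').trans not_lt))
      (not_lt.symm.trans ((not_congr hlt').trans not_lt))
  · exact not_lt.symm.trans ((not_congr hlt').trans not_lt)
  · exact hgt'

theorem zero_mem_iff_getD_finsetCode (R : Finset (Fin 1)) :
    (finsetCode R).getD 0 false = true ↔ (0 : Fin 1) ∈ R :=
  getD_finsetCode R 0

/-- `clockRank` is monotone, sends `0` to `0` and preserves guards, so it respects delays, resets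
and tests. -/
theorem step_code_of_jointStep (A : PTA nA nL 1 nP) {u : List ℕ}
    (hu : u ∈ gridVectors A.code.gridSize nP) {s s' : Fin nL × ClockVal 1}
    (h : A.JointStep (ParamVal.ofGrid nP u) s s') :
    A.code.Step u (s.1, clockRank nP A.code.gridSize s.2)
      (s'.1, clockRank nP A.code.gridSize s'.2) := by
  obtain ⟨e, he, y, h1, h2, h3, h4, h5, h6, h7⟩ := h
  have hA := A.constsLe_maxConst
  have hN : A.code.maxConst * (nP + 1) ≤ A.code.gridSize :=
    Nat.mul_le_mul_right _ (Nat.le_succ _)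
  have hsat : ∀ {g : Guard 1 nP}, g.ConstsLe A.code.maxConst → ∀ w : ClockVal 1,
      (GuardCode.Sat nP u (Guard.code g) (clockRank nP A.code.gridSize w) ↔
        g.sat w (ParamVal.ofGrid nP u)) := fun hg w =>
    sat_code_iff hg hN hu fun k hk r => holds_clockRank_iff w hk r
  refine ⟨e.code, List.mem_map_of_mem he, clockRank nP A.code.gridSize y,
    List.mem_range.2 (clockRank_lt _ _ _), congrArg Fin.val h1, congrArg Fin.val h2, s'.1.2,
    clockRank_mono _ _ h3, ?_, (hsat (hA.2 e he) y).2 h5, ?_, ?_⟩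
  · simp only [invCode_code]
    exact (hsat (hA.1 _) y).2 h4
  · simp only [Edge.code, zero_mem_iff_getD_finsetCode, h6]
    by_cases hR : (0 : Fin 1) ∈ e.resets
    · rw [if_pos hR, show reset y e.resets = 0 from clockVal_ext (by simp [reset, hR]),
        clockRank_zero]
    · rw [if_neg hR, show reset y e.resets = y from clockVal_ext (by simp [reset, hR])]
  · simp only [invCode_code]
    exact (hsat (hA.1 _) _).2 h7

theorem sat_clockOfNat_iff (A : PTA nA nL 1 nP) {u : List ℕ}
    (hu : u ∈ gridVectors A.code.gridSize nP) {g : Guard 1 nP}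
    (hg : g.ConstsLe A.code.maxConst) (y : ℕ) :
    GuardCode.Sat nP u (Guard.code g) y ↔ g.sat (clockOfNat nP y) (ParamVal.ofGrid nP u) :=
  sat_code_iff hg (Nat.mul_le_mul_right _ (Nat.le_succ _)) hu
    fun k _ r => holds_clockOfNat_iff nP y k r

theorem clockOfNat_zero (n : ℕ) : clockOfNat n 0 = 0 := by
  funext x
  simp [clockOfNat]

/-- The converse simulation, by `clockOfNat`. The new location is the target of an actual edge,
hence an element of `Fin nL`. -/
theorem exists_jointStep_of_step_code (A : PTA nA nL 1 nP) {u : List ℕ}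
    (hu : u ∈ gridVectors A.code.gridSize nP) {l : Fin nL} {y : ℕ} {s' : ℕ × ℕ}
    (h : A.code.Step u (l, y) s') : ∃ l' : Fin nL, s'.1 = l' ∧
      A.JointStep (ParamVal.ofGrid nP u) (l, clockOfNat nP y) (l', clockOfNat nP s'.2) := by
  obtain ⟨l', y'⟩ := s'
  obtain ⟨ec, hec, z, -, h1, h2, -, h3, h4, h5, h6, h7⟩ := h
  obtain ⟨e, he, rfl⟩ := List.mem_map.1 hec
  have hA := A.constsLe_maxConst
  simp only [Edge.code, zero_mem_iff_getD_finsetCode] at h1 h2 h3 h4 h5 h6 h7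
  subst h2
  refine ⟨e.tgt, rfl, e, he, clockOfNat nP z, Fin.ext h1, rfl, fun x => ?_, ?_,
    (A.sat_clockOfNat_iff hu (hA.2 e he) z).1 h5, ?_, ?_⟩
  · simp only [clockOfNat]
    gcongr
  · rw [invCode_code] at h4
    exact (A.sat_clockOfNat_iff hu (hA.1 _) z).1 h4
  · simp only [h6]
    by_cases hR : (0 : Fin 1) ∈ e.resets
    · rw [if_pos hR, show reset (clockOfNat nP z) e.resets = 0 from
        clockVal_ext (by simp [reset, hR]), clockOfNat_zero]
    · rw [if_neg hR, show reset (clockOfNat nP z) e.resets = clockOfNat nP z from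
        clockVal_ext (by simp [reset, hR])]
  · rw [invCode_code] at h7
    exact (A.sat_clockOfNat_iff hu (hA.1 _) _).1 h7

/-- For grid valuations, reachability can be read off from the description of the automaton. -/
theorem reach_code_iff (A : PTA nA nL 1 nP) (T : Finset (Fin nL)) {u : List ℕ}
    (hu : u ∈ gridVectors A.code.gridSize nP) :
    A.code.Reach (finsetCode T) u ↔ (A.Reach (ParamVal.ofGrid nP u) T).Nonempty := by
  have hA := A.constsLe_maxConst
  have hinit : (A.code.invCode A.code.2.1).Sat A.code.numParams u 0 ↔
      (A.init, 0) ∈ A.states (ParamVal.ofGrid nP u) := by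
    have h1 : A.code.invCode A.code.2.1 = Guard.code (A.inv A.init) := A.invCode_code A.init
    have h2 := A.sat_clockOfNat_iff hu (hA.1 A.init) 0
    rw [clockOfNat_zero] at h2
    rw [h1]
    exact h2
  rw [reach_nonempty_iff]
  refine and_congr hinit ⟨?_, ?_⟩
  · rintro ⟨l, hl, hT, y, -, h⟩
    have key : ∀ s : ℕ × ℕ, Relation.ReflTransGen (A.code.Step u) (A.code.2.1, 0) s →
        ∃ l' : Fin nL, s.1 = l' ∧ Relation.ReflTransGen (A.JointStep (ParamVal.ofGrid nP u))
          (A.init, 0) (l', clockOfNat nP s.2) := by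
      intro s hs
      induction hs with
      | refl => exact ⟨A.init, rfl, by rw [clockOfNat_zero]⟩
      | @tail a b _ hab ih =>
        obtain ⟨la, hla, hra⟩ := ih
        obtain ⟨a1, a2⟩ := a
        simp only at hla
        subst hla
        obtain ⟨lb, hlb, hrb⟩ := A.exists_jointStep_of_step_code hu hab
        exact ⟨lb, hlb, hra.tail hrb⟩
    obtain ⟨l', hl', hr⟩ := key _ h
    simp only at hl'
    subst hl'
    exact ⟨_, (getD_finsetCode T l').1 hT, hr⟩
  · rintro ⟨s, hsT, hs⟩
    refine ⟨s.1, List.mem_range.2 s.1.2, (getD_finsetCode T s.1).2 hsT,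
      clockRank nP A.code.gridSize s.2, List.mem_range.2 (clockRank_lt _ _ _), ?_⟩
    have := Relation.ReflTransGen.lift (p := A.code.Step u)
      (fun s : Fin nL × ClockVal 1 => ((s.1 : ℕ), clockRank nP A.code.gridSize s.2))
      (fun a b hab => A.step_code_of_jointStep hu hab) _ _ hs
    simp only [Function.onFun, clockRank_zero] at this
    exact this

end PTA

/-! ### Primitive recursive predicates on finite data -/

open Classical in
/-- One round of the saturation of a list under a relation, starting with `i`, inside `all`. -/
noncomputable def List.saturateStep {α : Type*} (all : List α) (i : α) (R : α → α → Prop) (L : List α) :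
    List α :=
  all.filter fun b => b = i ∨ ∃ a ∈ L, R a b

-- The rounds give an increasing chain of sublists of `all`. A sublist of equal length is equal, so
-- the chain is stationary as soon as the length repeats, which happens within `all.length` rounds.
open Classical in
theorem List.mem_saturate_iff {α : Type*} {all : List α} {i : α} {R : α → α → Prop} (hi : i ∈ all)
    (hR : ∀ a b, R a b → b ∈ all) {a : α} :
    a ∈ (all.saturateStep i R)^[all.length] [] ↔ Relation.ReflTransGen R i a := by
  set L : ℕ → List α := fun m => (all.saturateStep i R)^[m] [] with hL
  have hsucc : ∀ m, L (m + 1) = all.saturateStep i R (L m) := fun m =>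
    Function.iterate_succ_apply' _ _ _
  have hsub : ∀ m, (L m).Sublist (L (m + 1)) := by
    intro m
    induction m with
    | zero => exact List.nil_sublist _
    | succ m ih =>
      rw [hsucc, hsucc (m + 1)]
      refine List.monotone_filter_right all fun b hb => ?_
      simp only [decide_eq_true_eq] at hb ⊢
      exact hb.imp id fun ⟨a, ha, hab⟩ => ⟨a, ih.subset ha, hab⟩
  have hlen : ∀ m, (L m).length ≤ all.length := by
    intro m
    cases m with
    | zero => exact Nat.zero_le _
    | succ m =>
      rw [hsucc]
      exact List.length_filter_le _ _
  have hstab : ∀ m, (L m).length = (L (m + 1)).length → L m = L (m + 1) := fun m h =>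
    (hsub m).eq_of_length h
  have hfix : L all.length = L (all.length + 1) := by
    refine hstab _ (Nat.stabilises_of_monotone (f := fun m => (L m).length) (b := all.length)
      (n := all.length + 1) (monotone_nat_of_le_succ fun m => (hsub m).length_le) hlen
      (fun m h => ?_) (Nat.le_succ _)).symm
    have h' := hstab m h
    change (L (m + 1)).length = (L (m + 2)).length
    rw [hsucc (m + 1), ← h', ← hsucc]
    exact h
  constructor
  · change a ∈ L all.length → _
    generalize all.length = m
    induction m generalizing a with
    | zero => intro h; simp [hL] at h
    | succ m ih =>
      rw [hsucc]
      intro h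
      rcases of_decide_eq_true (List.mem_filter.1 h).2 with rfl | ⟨b, hb, hba⟩
      · exact .refl
      · exact (ih hb).tail hba
  · change _ → a ∈ L all.length
    intro h
    induction h with
    | refl =>
      rw [hfix, hsucc]
      exact List.mem_filter.2 ⟨hi, by simp⟩
    | @tail b c _ hbc ih =>
      rw [hfix, hsucc]
      exact List.mem_filter.2 ⟨hR b c hbc, decide_eq_true (Or.inr ⟨b, ih, hbc⟩)⟩

section Primrec

variable {γ α β : Type*} [Primcodable γ] [Primcodable α] [Primcodable β]

theorem PrimrecRel.exists_mem {f : γ → List α} {Q : γ → α → Prop} (hf : Primrec f)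
    (hQ : PrimrecRel Q) : PrimrecPred fun c => ∃ a ∈ f c, Q c a :=
  (PrimrecRel.exists_mem_list hQ.swap).comp hf Primrec.id

theorem PrimrecRel.forall_mem {f : γ → List α} {Q : γ → α → Prop} (hf : Primrec f)
    (hQ : PrimrecRel Q) : PrimrecPred fun c => ∀ a ∈ f c, Q c a :=
  (PrimrecRel.forall_mem_list hQ.swap).comp hf Primrec.id

open Classical in
theorem PrimrecRel.filter {f : γ → List α} {Q : γ → α → Prop} (hf : Primrec f)
    (hQ : PrimrecRel Q) : Primrec fun c => (f c).filter fun a => Q c a :=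
  (PrimrecRel.listFilter (R := fun a c => Q c a) hQ.swap).comp hf Primrec.id

/-- Reachability in finite graphs is primitive recursive. -/
theorem primrecRel_reflTransGen {all : γ → List α} (hall : Primrec all) {i : γ → α}
    (hi : Primrec i) {R : γ → α → α → Prop}
    (hR : PrimrecPred fun q : γ × α × α => R q.1 q.2.1 q.2.2)
    (hsub : ∀ c a b, R c a b → b ∈ all c) :
    PrimrecRel fun c a => Relation.ReflTransGen (R c) (i c) a := by
  -- Only targets of `R` are known to lie in `all c`; the starting point is added by hand.
  have hall' : Primrec fun c => i c :: all c := Primrec.list_cons.comp hi hall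
  have hstep : Primrec₂ fun (c : γ) (L : List α) =>
      (i c :: all c).saturateStep (i c) (R c) L := by
    refine (PrimrecRel.filter (Q := fun (q : γ × List α) b => b = i q.1 ∨ ∃ a ∈ q.2, R q.1 a b)
      (hall'.comp Primrec.fst) (PrimrecPred.or ?_ ?_)).of_eq fun q => ?_
    · exact Primrec.eq.comp Primrec.snd (hi.comp (Primrec.fst.comp Primrec.fst))
    · refine PrimrecRel.exists_mem (Q := fun (x : (γ × List α) × α) a => R x.1.1 a x.2)
        (Primrec.snd.comp Primrec.fst) ?_
      exact hR.comp (Primrec.pair (Primrec.fst.comp (Primrec.fst.comp Primrec.fst))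
        (Primrec.pair Primrec.snd (Primrec.snd.comp Primrec.fst)))
    · exact List.filter_congr fun b _ => by simp
  have hiter : Primrec fun c =>
      ((i c :: all c).saturateStep (i c) (R c))^[(i c :: all c).length] [] :=
    Primrec.nat_iterate (Primrec.list_length.comp hall') (Primrec.const []) hstep
  have hmem : PrimrecPred fun q : γ × α =>
      ∃ a ∈ ((i q.1 :: all q.1).saturateStep (i q.1) (R q.1))^[(i q.1 :: all q.1).length] [],
        a = q.2 :=
    PrimrecRel.exists_mem (hiter.comp Primrec.fst)
      (Primrec.eq.comp Primrec.snd (Primrec.snd.comp Primrec.fst))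
  refine hmem.of_eq fun q => ?_
  simp only [exists_eq_right]
  exact List.mem_saturate_iff List.mem_cons_self
    fun a b hab => List.mem_cons_of_mem _ (hsub _ a b hab)

end Primrec

/-! ### Computability of the synthesis function -/

instance : Finite CmpSym := Finite.of_equiv (Fin 5) CmpSym.equivFin.symm

theorem CmpSym.primrecPred_holds :
    PrimrecPred fun q : CmpSym × ℕ × ℕ => q.1.holds (q.2.1 : ℝ) (q.2.2 : ℝ) := by
  have hsym : ∀ t : CmpSym → Bool, PrimrecPred fun q : CmpSym × ℕ × ℕ => t q.1 = true :=
    fun t => Primrec.eq.comp ((Primrec.dom_finite t).comp Primrec.fst) (Primrec.const true)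
  have h1 : Primrec fun q : CmpSym × ℕ × ℕ => q.2.1 := Primrec.fst.comp Primrec.snd
  have h2 : Primrec fun q : CmpSym × ℕ × ℕ => q.2.2 := Primrec.snd.comp Primrec.snd
  -- Split by the outcome `<`, `=` or `>` of the comparison, each with the list of symbols that it
  -- satisfies.
  refine (((hsym fun r => decide (r = lt ∨ r = le)).and (Primrec.nat_lt.comp h1 h2)).or
    (((hsym fun r => decide (r = le ∨ r = eq ∨ r = ge)).and (Primrec.eq.comp h1 h2)).or
    ((hsym fun r => decide (r = ge ∨ r = gt)).and (Primrec.nat_lt.comp h2 h1)))).of_eq ?_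
  rintro ⟨r, a, b⟩
  cases r <;> simp [CmpSym.holds, le_iff_lt_or_eq, eq_comm, or_comm]

theorem CmpSym.primrec_between : Primrec₂ CmpSym.between :=
  Primrec.ite Primrec.nat_lt (Primrec.const _)
    (Primrec.ite Primrec.eq (Primrec.const _) (Primrec.const _))

/-- The encoding of `ℤ` sends `k` to `2 * k` and `Int.negSucc k` to `2 * k + 1`. -/
theorem primrec_int_ofNat : Primrec fun k : ℕ => (k : ℤ) :=
  Primrec.encode_iff.1 (Primrec.nat_double.of_eq fun _ => rfl)

theorem primrec_int_negSucc : Primrec fun k : ℕ => Int.negSucc k :=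
  Primrec.encode_iff.1 (Primrec.nat_double_succ.of_eq fun _ => rfl)

theorem primrec_int_sub : Primrec₂ fun a b : ℕ => (a : ℤ) - (b : ℤ) := by
  refine (Primrec.ite (c := fun q : ℕ × ℕ => q.2 ≤ q.1)
    (Primrec.nat_le.comp Primrec.snd Primrec.fst)
    (primrec_int_ofNat.comp (Primrec.nat_sub.comp Primrec.fst Primrec.snd))
    -- For `a < b`, the difference is `Int.negSucc (b - a - 1)`.
    (primrec_int_negSucc.comp (Primrec.nat_sub.comp
      (Primrec.nat_sub.comp Primrec.snd Primrec.fst) (Primrec.const 1)))).of_eq ?_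
  rintro ⟨a, b⟩
  simp only
  split_ifs with h
  · omega
  · rw [Int.negSucc_eq]
    omega

theorem primrec_boundCode :
    Primrec fun q : (ℕ × List ℕ) × (ℕ ⊕ ℕ) => boundCode q.1.1 q.1.2 q.2 := by
  refine (Primrec.sumCasesOn (f := fun q : (ℕ × List ℕ) × (ℕ ⊕ ℕ) => q.2)
    (g := fun q d => 2 * (d * (q.1.1 + 1))) (h := fun q i => 2 * q.1.2.getD i 0)
    Primrec.snd ?_ ?_).of_eq ?_
  · exact Primrec.nat_double.comp (Primrec.nat_mul.comp Primrec.snd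
      (Primrec.succ.comp (Primrec.fst.comp (Primrec.fst.comp Primrec.fst))))
  · exact Primrec.nat_double.comp ((Primrec.list_getD 0).comp
      (Primrec.snd.comp (Primrec.fst.comp Primrec.fst)) Primrec.snd)
  · rintro ⟨⟨n, u⟩, d | i⟩ <;> rfl

theorem primrecPred_guardCode_sat : PrimrecPred fun q : (ℕ × List ℕ) × GuardCode × ℕ =>
    GuardCode.Sat q.1.1 q.1.2 q.2.1 q.2.2 := by
  refine PrimrecRel.forall_mem (Primrec.fst.comp Primrec.snd) ?_
  have ha : Primrec fun x : ((ℕ × List ℕ) × GuardCode × ℕ) × (ℕ × CmpSym × (ℕ ⊕ ℕ)) => x.2.2 :=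
    Primrec.snd.comp Primrec.snd
  exact CmpSym.primrecPred_holds.comp (Primrec.pair (Primrec.fst.comp ha)
    (Primrec.pair (Primrec.snd.comp (Primrec.snd.comp Primrec.fst))
      (primrec_boundCode.comp (Primrec.pair (Primrec.fst.comp Primrec.fst)
        (Primrec.snd.comp ha)))))

theorem GuardCode.primrecPred_sat {γ : Type*} [Primcodable γ] {n : γ → ℕ} {u : γ → List ℕ}
    {g : γ → GuardCode} {y : γ → ℕ} (hn : Primrec n) (hu : Primrec u) (hg : Primrec g)
    (hy : Primrec y) : PrimrecPred fun c => GuardCode.Sat (n c) (u c) (g c) (y c) :=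
  primrecPred_guardCode_sat.comp (Primrec.pair (Primrec.pair hn hu) (Primrec.pair hg hy))

namespace PTACode

theorem primrec_numParams : Primrec numParams :=
  Primrec.snd.comp (Primrec.snd.comp (Primrec.snd.comp Primrec.fst))

theorem primrec_numLocs : Primrec numLocs :=
  Primrec.fst.comp (Primrec.snd.comp Primrec.fst)

theorem primrec_init : Primrec fun c : PTACode => c.2.1 := Primrec.fst.comp Primrec.snd

theorem primrec_edges : Primrec fun c : PTACode => c.2.2.2 :=
  Primrec.snd.comp (Primrec.snd.comp Primrec.snd)

theorem primrec_invCode : Primrec₂ invCode :=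
  (Primrec.list_getD []).comp
    (Primrec.fst.comp (Primrec.snd.comp (Primrec.snd.comp Primrec.fst))) Primrec.snd

theorem primrec_maxConst : Primrec maxConst := by
  have h1 : Primrec fun c : PTACode => c.2.2.1.flatten :=
    Primrec.list_flatten.comp (Primrec.fst.comp (Primrec.snd.comp Primrec.snd))
  have h2 : Primrec fun c : PTACode => c.2.2.2.flatMap fun e => e.2.1 :=
    Primrec.list_flatMap primrec_edges
      ((Primrec.fst.comp (Primrec.snd.comp Primrec.snd) :
        Primrec fun q : PTACode × EdgeCode => q.2.2.1))
  have h3 : Primrec fun a : ℕ × CmpSym × (ℕ ⊕ ℕ) => Sum.elim id (fun _ => 0) a.2.2 := by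
    refine (Primrec.sumCasesOn (f := fun a : ℕ × CmpSym × (ℕ ⊕ ℕ) => a.2.2)
      (g := fun _ d => d) (h := fun _ _ => 0)
      (Primrec.snd.comp Primrec.snd) Primrec₂.right (Primrec₂.const 0)).of_eq ?_
    rintro ⟨a, r, d | i⟩ <;> rfl
  have h4 : Primrec fun L : List ℕ => L.foldr max 0 :=
    Primrec.list_foldr (h := fun _ q => max q.1 q.2) Primrec.id (Primrec.const 0)
      (Primrec.nat_max.comp (Primrec.fst.comp Primrec.snd) (Primrec.snd.comp Primrec.snd))
  have h5 : Primrec fun c : PTACode => (c.2.2.1.flatten ++ c.2.2.2.flatMap fun e => e.2.1).map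
      fun a => Sum.elim id (fun _ => 0) a.2.2 :=
    Primrec.list_map (Primrec.list_append.comp h1 h2) (h3.comp Primrec.snd)
  exact h4.comp h5

theorem primrec_gridSize : Primrec gridSize :=
  Primrec.nat_mul.comp (Primrec.succ.comp primrec_maxConst) (Primrec.succ.comp primrec_numParams)

theorem primrec_clockValues : Primrec fun c : PTACode => List.range (2 * c.gridSize + 2) :=
  Primrec.list_range.comp (Primrec.succ.comp (Primrec.succ.comp
    (Primrec.nat_double.comp primrec_gridSize)))

theorem primrecPred_step : PrimrecPred fun q : (PTACode × List ℕ) × (ℕ × ℕ) × (ℕ × ℕ) =>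
    Step q.1.1 q.1.2 q.2.1 q.2.2 := by
  have hc : Primrec fun q : (PTACode × List ℕ) × (ℕ × ℕ) × (ℕ × ℕ) => q.1.1 :=
    Primrec.fst.comp Primrec.fst
  refine PrimrecRel.exists_mem (primrec_edges.comp hc) (PrimrecRel.exists_mem
    (f := fun q : ((PTACode × List ℕ) × (ℕ × ℕ) × (ℕ × ℕ)) × EdgeCode =>
      List.range (2 * q.1.1.1.gridSize + 2)) (primrec_clockValues.comp (hc.comp Primrec.fst)) ?_)
  set γ := (((PTACode × List ℕ) × (ℕ × ℕ) × (ℕ × ℕ)) × EdgeCode) × ℕ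
  have hq : Primrec fun x : γ => x.1.1 := Primrec.fst.comp Primrec.fst
  have hc' : Primrec fun x : γ => x.1.1.1.1 := hc.comp hq
  have hu : Primrec fun x : γ => x.1.1.1.2 := Primrec.snd.comp (Primrec.fst.comp hq)
  have hs : Primrec fun x : γ => x.1.1.2.1 := Primrec.fst.comp (Primrec.snd.comp hq)
  have hs' : Primrec fun x : γ => x.1.1.2.2 := Primrec.snd.comp (Primrec.snd.comp hq)
  have he : Primrec fun x : γ => x.1.2 := Primrec.snd.comp Primrec.fst
  have hy : Primrec fun x : γ => x.2 := Primrec.snd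
  have hn := primrec_numParams.comp hc'
  have hfl : Primrec fun x : γ => x.1.2.2.2.2 :=
    Primrec.snd.comp (Primrec.snd.comp (Primrec.snd.comp he))
  refine (Primrec.eq.comp (Primrec.fst.comp hs) (Primrec.fst.comp he)).and <|
    (Primrec.eq.comp (Primrec.fst.comp hs') (Primrec.snd.comp hfl)).and <|
    (Primrec.nat_lt.comp (Primrec.fst.comp hs') (primrec_numLocs.comp hc')).and <|
    (Primrec.nat_le.comp (Primrec.snd.comp hs) hy).and <|
    (GuardCode.primrecPred_sat hn hu (primrec_invCode.comp hc' (Primrec.fst.comp hs)) hy).and <|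
    (GuardCode.primrecPred_sat hn hu (Primrec.fst.comp (Primrec.snd.comp he)) hy).and <|
    (Primrec.eq.comp (Primrec.snd.comp hs') (Primrec.ite ?_ (Primrec.const 0) hy)).and <|
    GuardCode.primrecPred_sat hn hu (primrec_invCode.comp hc' (Primrec.fst.comp hs'))
      (Primrec.snd.comp hs')
  exact Primrec.eq.comp ((Primrec.list_getD false).comp (Primrec.fst.comp hfl) (Primrec.const 0))
    (Primrec.const true)

theorem primrecPred_reach :
    PrimrecPred fun q : (PTACode × List Bool) × List ℕ => Reach q.1.1 q.1.2 q.2 := by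
  have hall : Primrec fun q : PTACode × List ℕ => (List.range q.1.numLocs).flatMap fun l =>
      (List.range (2 * q.1.gridSize + 2)).map fun y => (l, y) := by
    refine Primrec.list_flatMap (Primrec.list_range.comp (primrec_numLocs.comp Primrec.fst)) ?_
    exact Primrec.list_map (primrec_clockValues.comp (Primrec.fst.comp Primrec.fst))
      (Primrec.pair (Primrec.snd.comp Primrec.fst) Primrec.snd)
  have hrt := primrecRel_reflTransGen (i := fun q : PTACode × List ℕ => (q.1.2.1, 0))
    (R := fun q => Step q.1 q.2) hall
    (Primrec.pair (primrec_init.comp Primrec.fst) (Primrec.const 0)) primrecPred_step (by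
      -- The bounds on location and clock value that are part of `Step` confine the graph to the
      -- list, even for data that describe no automaton.
      rintro c a ⟨l, z⟩ ⟨e, -, y, hy, -, -, hl, -, -, -, hz, -⟩
      refine List.mem_flatMap.2 ⟨l, List.mem_range.2 hl, List.mem_map.2 ⟨z, ?_, rfl⟩⟩
      rw [List.mem_range] at hy ⊢
      simp only at hz
      split_ifs at hz <;> omega)
  have hc : Primrec fun q : (PTACode × List Bool) × List ℕ => q.1.1 := Primrec.fst.comp Primrec.fst
  refine (GuardCode.primrecPred_sat (primrec_numParams.comp hc) Primrec.snd
    (primrec_invCode.comp hc (primrec_init.comp hc)) (Primrec.const 0)).and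
    (PrimrecRel.exists_mem (Primrec.list_range.comp (primrec_numLocs.comp hc))
    (PrimrecPred.and ?_ (PrimrecRel.exists_mem
      (f := fun q : ((PTACode × List Bool) × List ℕ) × ℕ => List.range (2 * q.1.1.1.gridSize + 2))
      (primrec_clockValues.comp (hc.comp Primrec.fst)) ?_)))
  · exact Primrec.eq.comp ((Primrec.list_getD false).comp
      (Primrec.snd.comp (Primrec.fst.comp Primrec.fst)) Primrec.snd) (Primrec.const true)
  · have hq : Primrec fun x : (((PTACode × List Bool) × List ℕ) × ℕ) × ℕ => x.1.1 :=
      Primrec.fst.comp Primrec.fst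
    exact hrt.comp (Primrec.pair (hc.comp hq) (Primrec.snd.comp hq))
      (Primrec.pair (Primrec.snd.comp Primrec.fst) Primrec.snd)

end PTACode

theorem primrec_gridVectors : Primrec₂ gridVectors := by
  have h : Primrec₂ fun (N n : ℕ) => (Nat.rec [[]] (fun _ (L : List (List ℕ)) =>
      L.flatMap fun u => (List.range (N + 1)).map fun k => k :: u) n : List (List ℕ)) := by
    refine Primrec.nat_rec (f := fun _ : ℕ => [[]]) (g := fun N (q : ℕ × List (List ℕ)) =>
      q.2.flatMap fun u => (List.range (N + 1)).map fun k => k :: u) (Primrec.const _) ?_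
    refine Primrec.list_flatMap (Primrec.snd.comp Primrec.snd) ?_
    refine Primrec.list_map (f := fun q : (ℕ × ℕ × List (List ℕ)) × List ℕ =>
      List.range (q.1.1 + 1)) (Primrec.list_range.comp
        (Primrec.succ.comp (Primrec.fst.comp Primrec.fst))) ?_
    exact Primrec.list_cons.comp Primrec.snd (Primrec.snd.comp Primrec.fst)
  refine h.of_eq fun N n => ?_
  induction n with
  | zero => rfl
  | succ n ih => simp only [gridVectors, ← ih]

theorem primrec_diffCoeffs : Primrec fun q : ℕ × ℕ × ℕ => diffCoeffs q.1 q.2.1 q.2.2 := by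
  refine Primrec.list_map (Primrec.list_range.comp Primrec.fst) ?_
  have hk : ∀ {f : (ℕ × ℕ × ℕ) → ℕ}, Primrec f →
      Primrec fun x : (ℕ × ℕ × ℕ) × ℕ => decide (x.2 = f x.1) := fun hf =>
    (Primrec.eq.comp Primrec.snd (hf.comp Primrec.fst)).decide
  -- Each coefficient is a function of two Booleans, so no arithmetic on `ℤ` is needed.
  refine ((Primrec.dom_bool₂ fun a b => (if a = true then (1 : ℤ) else 0) -
    (if b = true then 1 else 0)).comp (hk (Primrec.fst.comp Primrec.snd))
      (hk (Primrec.snd.comp Primrec.snd))).of_eq ?_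
  rintro ⟨⟨n, i, j⟩, k⟩
  simp

theorem primrec_gridPoint : Primrec fun q : (ℕ × List ℕ) × ℕ => gridPoint q.1.1 q.1.2 q.2 := by
  have hn : Primrec fun q : (ℕ × List ℕ) × ℕ => q.1.1 := Primrec.fst.comp Primrec.fst
  exact Primrec.nat_add.comp
    ((Primrec.list_getD 0).comp (Primrec.snd.comp Primrec.fst) Primrec.snd)
    (Primrec.nat_mul.comp (Primrec.nat_sub.comp Primrec.snd hn) (Primrec.succ.comp hn))

theorem primrec_gridPoint_comp {γ : Type*} [Primcodable γ] {n : γ → ℕ} {u : γ → List ℕ} {i : γ → ℕ}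
    (hn : Primrec n) (hu : Primrec u) (hi : Primrec i) :
    Primrec fun c => gridPoint (n c) (u c) (i c) :=
  primrec_gridPoint.comp (Primrec.pair (Primrec.pair hn hu) hi)

theorem primrec_orderPolyhedron :
    Primrec fun q : (ℕ × ℕ) × List ℕ => orderPolyhedron q.1.1 q.1.2 q.2 := by
  have hr : Primrec fun q : (ℕ × ℕ) × List ℕ => List.range (q.1.1 + q.1.2 + 1) :=
    Primrec.list_range.comp (Primrec.succ.comp (Primrec.nat_add.comp
      (Primrec.fst.comp Primrec.fst) (Primrec.snd.comp Primrec.fst)))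
  have hq : Primrec fun x : (((ℕ × ℕ) × List ℕ) × ℕ) × ℕ => x.1.1 := Primrec.fst.comp Primrec.fst
  have hn : Primrec fun x : (((ℕ × ℕ) × List ℕ) × ℕ) × ℕ => x.1.1.1.1 :=
    Primrec.fst.comp (Primrec.fst.comp hq)
  have hu : Primrec fun x : (((ℕ × ℕ) × List ℕ) × ℕ) × ℕ => x.1.1.2 := Primrec.snd.comp hq
  have hi : Primrec fun x : (((ℕ × ℕ) × List ℕ) × ℕ) × ℕ => x.1.2 := Primrec.snd.comp Primrec.fst
  have hj : Primrec fun x : (((ℕ × ℕ) × List ℕ) × ℕ) × ℕ => x.2 := Primrec.snd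
  have h1 : Primrec fun x : (((ℕ × ℕ) × List ℕ) × ℕ) × ℕ => diffCoeffs x.1.1.1.1 x.1.2 x.2 :=
    primrec_diffCoeffs.comp (Primrec.pair hn (Primrec.pair hi hj))
  have h2 : Primrec fun x : (((ℕ × ℕ) × List ℕ) × ℕ) × ℕ =>
      ((x.1.2 - x.1.1.1.1 : ℕ) : ℤ) - ((x.2 - x.1.1.1.1 : ℕ) : ℤ) :=
    primrec_int_sub.comp (Primrec.nat_sub.comp hi hn) (Primrec.nat_sub.comp hj hn)
  have h3 : Primrec fun x : (((ℕ × ℕ) × List ℕ) × ℕ) × ℕ =>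
      CmpSym.between (gridPoint x.1.1.1.1 x.1.1.2 x.1.2) (gridPoint x.1.1.1.1 x.1.1.2 x.2) :=
    CmpSym.primrec_between.comp (primrec_gridPoint_comp hn hu hi) (primrec_gridPoint_comp hn hu hj)
  have h4 : Primrec₂ fun (x : ((ℕ × ℕ) × List ℕ) × ℕ) (j : ℕ) =>
      ((diffCoeffs x.1.1.1 x.2 j, ((x.2 - x.1.1.1 : ℕ) : ℤ) - ((j - x.1.1.1 : ℕ) : ℤ),
        CmpSym.between (gridPoint x.1.1.1 x.1.2 x.2) (gridPoint x.1.1.1 x.1.2 j)) : LinIneq) :=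
    Primrec.pair h1 (Primrec.pair h2 h3)
  have h5 : Primrec₂ fun (q : (ℕ × ℕ) × List ℕ) (i : ℕ) =>
      (List.range (q.1.1 + q.1.2 + 1)).map fun j =>
        ((diffCoeffs q.1.1 i j, ((i - q.1.1 : ℕ) : ℤ) - ((j - q.1.1 : ℕ) : ℤ),
          CmpSym.between (gridPoint q.1.1 q.2 i) (gridPoint q.1.1 q.2 j)) : LinIneq) :=
    Primrec.list_map (hr.comp Primrec.fst) h4
  exact Primrec.list_flatMap hr h5

theorem primrec_orderPolyhedron_comp {γ : Type*} [Primcodable γ] {n M : γ → ℕ} {u : γ → List ℕ}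
    (hn : Primrec n) (hM : Primrec M) (hu : Primrec u) :
    Primrec fun c => orderPolyhedron (n c) (M c) (u c) :=
  primrec_orderPolyhedron.comp (Primrec.pair (Primrec.pair hn hM) hu)

namespace PTACode

/-- The grid of parameter valuations. -/
def grid (c : PTACode) : List (List ℕ) := gridVectors c.gridSize c.numParams

theorem primrec_grid : Primrec grid :=
  primrec_gridVectors.comp primrec_gridSize primrec_numParams

/-- The grid valuation `u / (n + 1)` reaches `T`, its value of the parameter `p` is a natural number
that is at most `maxConst`, and no grid valuation that reaches `T` has a smaller value of `p`. -/
def IsOptimal (c : PTACode) (T : List Bool) (p : ℕ) (u : List ℕ) : Prop :=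
  c.Reach T u ∧ u.getD p 0 % (c.numParams + 1) = 0 ∧
    u.getD p 0 ≤ c.maxConst * (c.numParams + 1) ∧
    ∀ u' ∈ c.grid, c.Reach T u' → u.getD p 0 ≤ u'.getD p 0

open Classical in
/-- The synthesis function for automata with one clock. -/
noncomputable def synth (q : PTACode × List Bool × ℕ) : PolyhedraUnion :=
  (q.1.grid.filter fun u => q.1.IsOptimal q.2.1 q.2.2 u).map
    (orderPolyhedron q.1.numParams q.1.maxConst)

/-- `synth` filters with classical decidability; its effectiveness lies here, in that optimality
involves only finite graph search and quantifiers over computable lists. -/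
theorem primrec_synth : Primrec synth := by
  refine Primrec.list_map (PrimrecRel.filter (primrec_grid.comp Primrec.fst) ?_) ?_
  · set γ := (PTACode × List Bool × ℕ) × List ℕ
    have hc : Primrec fun x : γ => x.1.1 := Primrec.fst.comp Primrec.fst
    have hT : Primrec fun x : γ => x.1.2.1 := Primrec.fst.comp (Primrec.snd.comp Primrec.fst)
    have hp : Primrec fun x : γ => x.1.2.2 := Primrec.snd.comp (Primrec.snd.comp Primrec.fst)
    have hu : Primrec fun x : γ => x.2 := Primrec.snd
    have hup : Primrec fun x : γ => x.2.getD x.1.2.2 0 := (Primrec.list_getD 0).comp hu hp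
    have hn : Primrec fun x : γ => x.1.1.numParams + 1 :=
      Primrec.succ.comp (primrec_numParams.comp hc)
    refine (primrecPred_reach.comp (Primrec.pair (Primrec.pair hc hT) hu)).and <|
      (Primrec.eq.comp (Primrec.nat_mod.comp hup hn) (Primrec.const 0)).and <|
      (Primrec.nat_le.comp hup (Primrec.nat_mul.comp (primrec_maxConst.comp hc) hn)).and <|
      PrimrecRel.forall_mem (primrec_grid.comp hc) ?_
    have hR : PrimrecPred fun x : γ × List ℕ => x.1.1.1.Reach x.1.1.2.1 x.2 :=
      primrecPred_reach.comp (Primrec.pair (Primrec.pair (hc.comp Primrec.fst)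
        (hT.comp Primrec.fst)) Primrec.snd)
    have hle : PrimrecPred fun x : γ × List ℕ =>
        x.1.2.getD x.1.1.2.2 0 ≤ x.2.getD x.1.1.2.2 0 :=
      Primrec.nat_le.comp (hup.comp Primrec.fst)
        ((Primrec.list_getD 0).comp Primrec.snd (hp.comp Primrec.fst))
    exact (hR.not.or hle).of_eq fun x => imp_iff_not_or.symm
  · have h : Primrec fun x : (PTACode × List Bool × ℕ) × List ℕ =>
        orderPolyhedron x.1.1.numParams x.1.1.maxConst x.2 :=
      primrec_orderPolyhedron_comp (primrec_numParams.comp (Primrec.fst.comp Primrec.fst))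
        (primrec_maxConst.comp (Primrec.fst.comp Primrec.fst)) Primrec.snd
    exact h

end PTACode

/-! ### Correctness of the synthesis function -/

/-- The function that moves the points of the open interval between `a` and `a + 1` (or of the
half-line above `a`, if `a` is at least `M`) towards `a`. -/
theorem stretch_shrink (M a : ℕ) : Stretch M fun x : ℝ =>
    if (a : ℝ) < x ∧ (x < a + 1 ∨ M ≤ a) then (a + x) / 2 else x where
  strictMono := by
    intro x y hxy
    simp only
    split_ifs with hx hy hy
    · linarith
    · linarith [hx.1]
    · by_cases hxa : (a : ℝ) < x
      · have hx' : ¬ (x < a + 1 ∨ M ≤ a) := fun h => hx ⟨hxa, h⟩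
        push Not at hx'
        rcases hy.2 with h | h
        · linarith [hx'.1]
        · omega
      · linarith [hy.1, not_lt.1 hxa]
    · exact hxy
  map_nat := by
    intro d hd
    refine if_neg ?_
    rintro ⟨h1, h2⟩
    rw [Nat.cast_lt] at h1
    rcases h2 with h2 | h2
    · have : d < a + 1 := by exact_mod_cast h2
      omega
    · omega

namespace PTA

variable {nA nL nP : ℕ}

/-- If the value of `p` is not a natural number up to `M`, it can be decreased. -/
theorem exists_reach_lt {A : PTA nA nL 1 nP} {M : ℕ} (hA : A.ConstsLe M) {T : Finset (Fin nL)}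
    {v : ParamVal nP} (hv : (A.Reach v T).Nonempty) {p : Fin nP}
    (hp : ∀ d : ℕ, d ≤ M → v p ≠ d) : ∃ v', (A.Reach v' T).Nonempty ∧ v' p < v p := by
  -- The largest of `0, …, M` that does not exceed `v p`. Since `v p` differs from it, shrinking
  -- towards `a` moves `v p`.
  set a : ℕ := min ⌊v p⌋₊ M with ha
  -- The map of `stretch_shrink`, repeated over `ℚ≥0`: it preserves rationality, as a parameter
  -- valuation requires.
  set v' : ParamVal nP := fun i =>
    if (a : ℚ≥0) < v i ∧ (v i < a + 1 ∨ M ≤ a) then (a + v i) / 2 else v i with hv'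
  refine ⟨v', reach_nonempty_of_stretch hA (stretch_shrink M a) (fun i => ?_) hv, ?_⟩
  · have h1 : (a : ℝ) < ((v i : ℚ) : ℝ) ↔ (a : ℚ≥0) < v i := by norm_cast
    have h2 : ((v i : ℚ) : ℝ) < (a : ℝ) + 1 ↔ v i < (a : ℚ≥0) + 1 := by norm_cast
    simp only [hv', h1, h2]
    split_ifs
    · push_cast
      rfl
    · rfl
  · have hle : (a : ℚ≥0) ≤ v p :=
      (Nat.cast_le.2 (min_le_left _ _)).trans (Nat.floor_le zero_le)
    have hlt : (a : ℚ≥0) < v p := lt_of_le_of_ne hle (hp a (min_le_right _ _)).symm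
    have hcond : (a : ℚ≥0) < v p ∧ (v p < a + 1 ∨ M ≤ a) := by
      refine ⟨hlt, ?_⟩
      rcases le_total M ⌊v p⌋₊ with h | h
      · exact Or.inr (by omega)
      · refine Or.inl ?_
        rw [ha, min_eq_left h]
        exact Nat.lt_floor_add_one _
    simp only [hv', if_pos hcond]
    rw [div_lt_iff₀ two_pos, mul_two]
    exact add_lt_add_left hlt _

theorem ofGrid_le_ofGrid_iff {u u' : List ℕ} (p : Fin nP) :
    ParamVal.ofGrid nP u p ≤ ParamVal.ofGrid nP u' p ↔ u.getD p 0 ≤ u'.getD p 0 := by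
  have hn : (0 : ℚ≥0) < (nP : ℚ≥0) + 1 := by positivity
  simp only [ParamVal.ofGrid]
  rw [div_le_div_iff_of_pos_right hn, Nat.cast_le]

/-- Order equivalence preserves comparisons with the constants `0, …, M` but not comparisons between
values of `p` under different valuations. Optimality on the grid therefore transfers to all
valuations only through an optimum that is one of these constants, and by `exists_reach_lt` every
attained optimum is. -/
theorem toSet_synth (A : PTA nA nL 1 nP) (T : Finset (Fin nL)) (p : Fin nP) :
    (PTACode.synth (A.code, finsetCode T, (p : ℕ))).toSet nP = A.minParamSynth p T := by
  classical
  set M := A.code.maxConst with hM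
  have hA : A.ConstsLe M := A.constsLe_maxConst
  have hn : (nP : ℝ) + 1 ≠ 0 := by positivity
  have hreach : ∀ {v v' : ParamVal nP}, ParamVal.OrderEquiv M v v' →
      (A.Reach v T).Nonempty → (A.Reach v' T).Nonempty := by
    intro v v' h hv
    obtain ⟨φ, hφ, hφ'⟩ := h.exists_stretch
    exact reach_nonempty_of_stretch hA hφ hφ' hv
  have hcode : ∀ {u}, u ∈ A.code.grid →
      (A.code.Reach (finsetCode T) u ↔ (A.Reach (ParamVal.ofGrid nP u) T).Nonempty) := fun hu =>
    A.reach_code_iff T hu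
  have hlen : ∀ {u}, u ∈ A.code.grid → u.length = nP := fun hu => (mem_gridVectors_iff.1 hu).1
  ext v
  rw [mem_minParamSynth_iff]
  simp only [PolyhedraUnion.toSet, PTACode.synth, Set.mem_ofPred_eq, List.mem_map, List.mem_filter,
    decide_eq_true_eq]
  constructor
  · rintro ⟨_, ⟨u, ⟨hu, hopt⟩, rfl⟩, hv⟩
    obtain ⟨h1, h2, h3, h4⟩ := hopt
    have hvu : ParamVal.OrderEquiv M v (ParamVal.ofGrid nP u) :=
      (ParamVal.sat_orderPolyhedron_iff_orderEquiv M (hlen hu) v).1 hv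
    refine ⟨hreach hvu.symm ((hcode hu).1 h1), fun v' hv' => ?_⟩
    obtain ⟨d, hd⟩ := Nat.dvd_of_mod_eq_zero h2
    have hnum : A.code.numParams = nP := rfl
    rw [hnum] at hd h3
    have hdM : d ≤ M := by
      rw [hd, mul_comm] at h3
      exact Nat.le_of_mul_le_mul_right h3 (Nat.succ_pos _)
    have hup : ((ParamVal.ofGrid nP u p : ℚ) : ℝ) = d := by
      rw [ParamVal.coe_ofGrid, hd]
      push_cast
      rw [mul_div_cancel_left₀ _ hn]
    -- The chain `v p ≤ d ≤ v' p`: optimality on the grid gives `d` at most the value for `u'`, and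
    -- both inequalities with `d` pass from the grid to `v` and `v'`.
    obtain ⟨u', hu', hvu'⟩ := ParamVal.exists_gridVector M v'
    have hle := (ofGrid_le_ofGrid_iff p).2 (h4 u' hu' ((hcode hu').2 (hreach hvu' hv')))
    have hle' : (d : ℝ) ≤ ((ParamVal.ofGrid nP u' p : ℚ) : ℝ) := by
      rw [← hup]
      exact_mod_cast hle
    have hvp : ((v p : ℚ) : ℝ) ≤ d := (hvu.le_const_iff p hdM).2 hup.le
    have hvp' : (d : ℝ) ≤ ((v' p : ℚ) : ℝ) := (hvu'.const_le_iff p hdM).2 hle'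
    exact_mod_cast hvp.trans hvp'
  · rintro ⟨hv, hmin⟩
    obtain ⟨d, hdM, hd⟩ : ∃ d : ℕ, d ≤ M ∧ v p = d := by
      by_contra! hno
      obtain ⟨v', hv', hlt⟩ := exists_reach_lt hA hv hno
      exact absurd (hmin v' hv') (not_le.2 hlt)
    obtain ⟨u, hu, hvu⟩ := ParamVal.exists_gridVector M v
    refine ⟨_, ⟨u, ⟨hu, ?_⟩, rfl⟩,
      (ParamVal.sat_orderPolyhedron_iff_orderEquiv M (hlen hu) v).2 hvu⟩
    have hvd : ((v p : ℚ) : ℝ) = d := by rw [hd]; simp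
    have hup : ((ParamVal.ofGrid nP u p : ℚ) : ℝ) = d :=
      le_antisymm ((hvu.le_const_iff p hdM).1 hvd.le) ((hvu.const_le_iff p hdM).1 hvd.ge)
    have hud : u.getD p 0 = d * (nP + 1) := by
      rw [ParamVal.coe_ofGrid, div_eq_iff hn] at hup
      exact_mod_cast hup
    refine ⟨(hcode hu).2 (hreach hvu hv), ?_, ?_, fun u' hu' h' => ?_⟩
    · simp only [hud]
      exact Nat.mul_mod_left _ _
    · simp only [hud]
      exact Nat.mul_le_mul_right _ hdM
    · rw [← ofGrid_le_ofGrid_iff]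
      have hle := hmin _ ((hcode hu').1 h')
      -- The representative of `v` has the very same value of `p`, because `v p` equals a constant
      -- up to `M`.
      have heq : ParamVal.ofGrid nP u p = v p := by
        have := hup.trans hvd.symm
        exact_mod_cast this
      rwa [heq]

end PTA

theorem mainTheorem3 :
    (∃ f : PTACode × List Bool × ℕ → PolyhedraUnion, Computable f ∧
      ∀ (nA nL nP : ℕ) (A : PTA nA nL 1 nP) (T : Finset (Fin nL)) (p : Fin nP),
        (f (A.code, finsetCode T, (p : ℕ))).toSet nP = A.minParamSynth p T) ∧
    (∀ (nA nL nP : ℕ) (A : PTA nA nL 1 nP) (T : Finset (Fin nL)) (p : Fin nP),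
      A.Terminates T p ∧
      ∀ c, A.IsFinal T p c →
        (∃ L : PolyhedraUnion, c.K = L.toSet nP) ∧
        (A.InitAdmissible →
          c.Opt = A.minParamReach p T ∧
          (∀ v ∈ c.K, (A.Reach v T).Nonempty) ∧
          A.minParamSynth p T = {v ∈ c.K | Minimum.attained ((v p : ℚ) : ℝ) = c.Opt})) :=
  ⟨⟨PTACode.synth, PTACode.primrec_synth.to_comp, fun _ _ _ A T p => A.toSet_synth T p⟩,
    fun _ _ _ A T p => ⟨PTA.terminates_of_constsLe A.constsLe_maxConst T p, fun _ hc =>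
      ⟨(hc.paramInvariant A.constsLe_maxConst).exists_eq_toSet, fun hadm =>
        ⟨hc.opt_eq hadm, fun _ hv => hc.reach_nonempty_of_mem_K hadm hv,
          hc.minParamSynth_eq hadm⟩⟩⟩⟩
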